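/- All graphs are finite and simple. For a graph $G$ and an integer $t\ge 1$, let $s_t(G)$ be the number of $t$-stars in $G$, i.e. the number of subgraphs of $G$ isomorphic to $K_{1,t}$ (so $s_1(G)=e(G)$, and $s_t(G)=\sum_{v\in V(G)}\binom{d(v)}{t}$ for $t\ge 2$). For integers $n,\ell,i$ with $-1\le \ell\le n-3$ and $1\le i\le \frac{n-1-\ell}{2}$, let $$G_n^{\ell}(i)=K_{i+\ell}+(I_i\cup K_{n-2i-\ell}),$$ where $I_i$ is the graph on $i$ vertices with no edges, $\cup$ is disjoint union, and $+$ is the join (all edges between the two parts are added); if $i+\ell=0$, this is $I_1\cup K_{n-1}$. Put $i_0=\left\lfloor\frac{n-1-\ell}{2}\right\rfloor$. A graph is Hamiltonian if it has a spanning cycle; traceable if it has a Hamilton path, that is, a path through all vertices; Hamiltonian-connected if every two distinct vertices are the ends of a Hamilton path; $k$-edge Hamiltonian if every linear forest (disjoint union of paths) in it with at most $k$ edges is contained in a Hamilton cycle of it; and $k$-Hamiltonian if removing any set of at most $k$ vertices leaves a Hamiltonian graph. Let $n$ and $t$ be integers with $1\le t\le n-1$, and consider the following conditions on an $n$-vertex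 graph $G$, each with an associated integer $\ell$: * (H1) $G$ is not Hamiltonian; $\ell=0$ (with $n\ge 3$). * (H2) $G$ is not traceable; $\ell=-1$ (with $n\ge 2$). * (H3) $G$ is not Hamiltonian-connected; $\ell=1$ (with $n\ge 4$). * (H4) $G$ is not $k$-edge Hamiltonian, for a given integer $k$ with $1\le k\le n-3$; $\ell=k$. * (H5) $G$ is not $k$-Hamiltonian, for a given integer $k$ with $1\le k\le n-3$; $\ell=k$. Then, for each of these conditions, every $n$-vertex graph $G$ satisfying it has $$s_t(G)\le\max\{s_t(G_n^{\ell}(1)),\,s_t(G_n^{\ell}(i_0))\},$$ and this bound is tight: for all such $n$, $t$ (and $k$), some $n$-vertex graph satisfying the condition attains equality. -/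

import Mathlib

namespace StarCount

open SimpleGraph

/-- `s_t(G)`: the number of `t`-stars in `G`, i.e. of subgraphs of `G` isomorphic to `K_{1,t}`. -/
noncomputable def starCount {V : Type*} [Fintype V] (t : ℕ) (G : SimpleGraph V) : ℕ :=
  G.copyCount (completeBipartiteGraph (Fin 1) (Fin t))

/-- The join `G + H`: the disjoint union of `G` and `H` together with all edges between them. -/
def join {V W : Type*} (G : SimpleGraph V) (H : SimpleGraph W) : SimpleGraph (V ⊕ W) :=
  (G ⊕g H) ⊔ completeBipartiteGraph V W

/-- The graph `K_{i+ℓ} + (I_i ∪ K_{n-2i-ℓ})` on `n` vertices, meant for `-1 ≤ ℓ ≤ n - 3` and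
`1 ≤ i ≤ (n - 1 - ℓ) / 2`. In this range all three parameters `i + ℓ`, `i`, `n - 2i - ℓ` are
nonnegative, so that `Int.toNat` does not truncate. If `i + ℓ = 0` (that is, `ℓ = -1` and `i = 1`),
the first part is empty and the graph is `I_1 ∪ K_{n-1}`. -/
def extremalGraph (n : ℕ) (ℓ i : ℤ) :
    SimpleGraph (Fin (i + ℓ).toNat ⊕ (Fin i.toNat ⊕ Fin (n - 2 * i - ℓ).toNat)) :=
  join (completeGraph (Fin (i + ℓ).toNat))
    (emptyGraph (Fin i.toNat) ⊕g completeGraph (Fin (n - 2 * i - ℓ).toNat))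

/-- The largest admissible index `i₀ = ⌊(n - 1 - ℓ) / 2⌋` (integer division by `2` rounds down). -/
def topIndex (n : ℕ) (ℓ : ℤ) : ℤ := (n - 1 - ℓ) / 2

variable {V : Type*} [DecidableEq V]

/-- `G` has a Hamilton path. -/
def IsTraceable (G : SimpleGraph V) : Prop :=
  ∃ (a b : V) (p : G.Walk a b), p.IsHamiltonian

/-- Any two distinct vertices of `G` are the ends of a Hamilton path. -/
def IsHamiltonianConnected (G : SimpleGraph V) : Prop :=
  ∀ a b : V, a ≠ b → ∃ p : G.Walk a b, p.IsHamiltonian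

/-- A linear forest: an acyclic graph with all degrees at most `2`, i.e. (for finite graphs) a
disjoint union of paths, one-vertex paths being allowed. -/
def IsLinearForest {V : Type*} (F : SimpleGraph V) : Prop :=
  F.IsAcyclic ∧ ∀ v, (F.neighborSet v).encard ≤ 2

/-- Every linear forest in `G` with at most `k` edges is contained in a Hamilton cycle of `G`.
(A Hamilton cycle passes through all vertices, so only the edges of the forest matter and it may be
taken to be spanning.) -/
def IsEdgeHamiltonian (k : ℕ) (G : SimpleGraph V) : Prop :=
  ∀ F : SimpleGraph V, F ≤ G → IsLinearForest F → F.edgeSet.encard ≤ k →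
    ∃ (a : V) (p : G.Walk a a), p.IsHamiltonianCycle ∧ ∀ e ∈ F.edgeSet, e ∈ p.edges

/-- The removal of any set of at most `k` vertices of `G` leaves a Hamiltonian graph. -/
def IsVertexHamiltonian [Fintype V] (k : ℕ) (G : SimpleGraph V) : Prop :=
  ∀ S : Finset V, S.card ≤ k → (G.induce {v | v ∉ S}).IsHamiltonian

end StarCount

/-! The upper bounds come from one statement: if a linear forest `F ≤ G` with at most k edges lies
in no Hamilton cycle, then G satisfies `DegreeCondition` with r = k + 1. To see this, enlarge G to
an edge-maximal graph with no Hamilton cycle through F. By Ore's exchange, which must spare at most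
k edges, non-adjacent vertices of that graph have degree sum below n + k. Chvátal's argument turns
this into a degree condition, and deleting the added edges preserves the condition
(`exists_degreeCondition`). Hamiltonicity is the case k = 0. Traceability is Hamiltonicity of the
cone. Hamilton-connectedness uses a one-edge forest, and k-Hamiltonicity uses the case k = 0 after
deleting vertices.

The condition with index m bounds the degrees by those of the extremal graph with i = m + 1
(`DegreeCondition.sum_choose_le`). The resulting sum is convex in m (`extremalSum_convex`), so it is
largest at an end of the range of m.

For tightness, a Hamilton cycle has exactly |A| darts leaving the clique part A. Entering the
independent part I, following the forest inside A, and reaching the rest require more than that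
(`not_hasHamiltonianCycleThrough`). -/

namespace StarCount

open SimpleGraph

/-! ### Hamilton paths and cycles: rotation, exchange and the Ore step. -/

section HamiltonWalks

set_option linter.unusedSectionVars false

variable {V : Type*} {G : SimpleGraph V}

lemma exists_append_of_mem_darts {u v : V} {p : G.Walk u v} {d : G.Dart} (h : d ∈ p.darts) :
    ∃ (q : G.Walk u d.fst) (r : G.Walk d.snd v), p = q.append (.cons d.adj r) := by
  induction p with
  | nil => simp at h
  | cons hadj p ih =>
    rw [Walk.darts_cons, List.mem_cons] at h
    rcases h with rfl | h
    · exact ⟨.nil, p, rfl⟩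
    · obtain ⟨q, r, rfl⟩ := ih h
      exact ⟨.cons hadj q, r, rfl⟩

variable [DecidableEq V]

lemma isHamiltonian_iff_nodup {u v : V} {p : G.Walk u v} :
    p.IsHamiltonian ↔ p.support.Nodup ∧ ∀ x, x ∈ p.support := by
  rw [← Walk.isPath_def]
  exact ⟨fun h => ⟨h.isPath, h.mem_support⟩, fun h => h.1.isHamiltonian_of_mem h.2⟩

variable [Fintype V]

/-- A Hamilton path whose ends are adjacent closes up to a Hamilton cycle. -/
lemma isHamiltonianCycle_cons {u v : V} {q : G.Walk u v} (hq : q.IsHamiltonian) (h : G.Adj v u)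
    (hn : 3 ≤ Fintype.card V) : (Walk.cons h q).IsHamiltonianCycle := by
  rw [Walk.isHamiltonianCycle_iff_isCycle_and_length_eq, Walk.cons_isCycle_iff]
  have hl := hq.length_eq
  refine ⟨⟨hq.isPath, fun he => ?_⟩, by rw [Walk.length_cons]; omega⟩
  rw [Sym2.eq_swap] at he
  have := hq.isPath.length_eq_one_of_mem_edges he
  omega

/-- Removing an edge from a Hamilton cycle leaves a Hamilton path. -/
lemma exists_isHamiltonian_of_mem_darts {a : V} {p : G.Walk a a} (hp : p.IsHamiltonianCycle)
    {d : G.Dart} (hd : d ∈ p.darts) :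
    ∃ q : G.Walk d.snd d.fst, q.IsHamiltonian ∧ (d.edge :: q.edges).Perm p.edges := by
  obtain ⟨q, r, rfl⟩ := exists_append_of_mem_darts hd
  refine ⟨r.append q, ?_, ?_⟩
  · intro x
    have := (Walk.isHamiltonianCycle_iff_isCycle_and_support_count_tail_eq_one.1 hp).2 x
    rw [Walk.tail_support_append, Walk.support_cons, List.tail_cons, List.count_append] at this
    rw [Walk.support_append, List.count_append]
    omega
  · rw [Walk.edges_append, Walk.edges_append, Walk.edges_cons]
    exact ((List.perm_append_comm).cons _).trans List.perm_middle.symm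

/-- The exchange step in the proof of Ore's theorem. -/
lemma exists_isHamiltonianCycle_of_exchange {u v : V} {q : G.Walk u v} (hq : q.IsHamiltonian)
    {d : G.Dart} (hd : d ∈ q.darts) (hu : G.Adj u d.snd) (hv : G.Adj v d.fst)
    (hn : 3 ≤ Fintype.card V) :
    ∃ p : G.Walk d.snd d.snd, p.IsHamiltonianCycle ∧ ∀ e ∈ q.edges, e ≠ d.edge → e ∈ p.edges := by
  obtain ⟨q₁, q₂, rfl⟩ := exists_append_of_mem_darts hd
  -- The new path follows q₁ from u, jumps to v and runs back along q₂ to `d.snd`; the edge from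
  -- `d.snd` to u closes it. Only the edge of d is lost.
  have hH : (q₁.append (.cons hv.symm q₂.reverse)).IsHamiltonian := by
    intro x
    have := hq x
    rw [Walk.support_append, Walk.support_cons, List.tail_cons, List.count_append] at this ⊢
    rw [Walk.support_reverse, List.count_reverse]
    exact this
  refine ⟨_, isHamiltonianCycle_cons hH hu.symm hn, fun e he hne => ?_⟩
  rw [Walk.edges_append, Walk.edges_cons, List.mem_append, List.mem_cons] at he
  rw [Walk.edges_cons, Walk.edges_append, Walk.edges_cons, Walk.edges_reverse]
  rcases he with he | he | he
  · simp [he]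
  · exact absurd he hne
  · simp [he]

lemma countP_eq_card_filter {α : Type*} [Fintype α] {l : List α} (hl : l.Nodup)
    (hmem : ∀ x, x ∈ l) (P : α → Prop) [DecidablePred P] :
    l.countP (fun x => decide (P x)) = (Finset.univ.filter P).card := by
  classical
  rw [List.countP_eq_length_filter, ← List.toFinset_card_of_nodup (hl.filter _)]
  congr 1
  ext x
  simp [hmem]

lemma countP_add_countP_le {α : Type*} (l : List α) (P Q : α → Bool) :
    l.countP P + l.countP Q ≤ l.length + l.countP (fun x => P x && Q x) := by
  induction l with
  | nil => simp
  | cons x l ih =>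
    simp only [List.countP_cons, List.length_cons]
    cases P x <;> cases Q x <;> simp <;> omega

/-- Along a Hamilton path from u, every vertex but u is the head of exactly one dart, and u is not
its own neighbour. -/
lemma countP_adj_snd_eq_degree [DecidableRel G.Adj] {u v : V} {q : G.Walk u v}
    (hq : q.IsHamiltonian) :
    q.darts.countP (fun d => decide (G.Adj u d.snd)) = G.degree u := by
  rw [← card_neighborFinset_eq_degree, neighborFinset_eq_filter,
    ← countP_eq_card_filter (isHamiltonian_iff_nodup.1 hq).1 hq.mem_support,
    ← Walk.cons_map_snd_darts, List.countP_cons, List.countP_map]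
  simp [Function.comp_def]

lemma countP_adj_fst_eq_degree [DecidableRel G.Adj] {u v : V} {q : G.Walk u v}
    (hq : q.IsHamiltonian) :
    q.darts.countP (fun d => decide (G.Adj v d.fst)) = G.degree v := by
  rw [← card_neighborFinset_eq_degree, neighborFinset_eq_filter,
    ← countP_eq_card_filter (isHamiltonian_iff_nodup.1 hq).1 hq.mem_support,
    ← Walk.map_fst_darts_append, List.countP_append, List.countP_map]
  simp [Function.comp_def]

lemma countP_mem_edgeSet_le {F : SimpleGraph V} {k : ℕ} (hF : F.edgeSet.encard ≤ k)
    {u v : V} {q : G.Walk u v} (hq : q.edges.Nodup) [DecidablePred (· ∈ F.edgeSet)] :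
    q.darts.countP (fun d => decide (d.edge ∈ F.edgeSet)) ≤ k := by
  have h : q.darts.countP (fun d => decide (d.edge ∈ F.edgeSet)) =
      q.edges.countP (fun e => decide (e ∈ F.edgeSet)) := by
    rw [Walk.edges, List.countP_map]; rfl
  rw [h, List.countP_eq_length_filter, ← List.toFinset_card_of_nodup (hq.filter _)]
  have : ((q.edges.filter (fun e => decide (e ∈ F.edgeSet))).toFinset : Set (Sym2 V)) ⊆
      F.edgeSet := by
    intro e he
    simp only [List.coe_toFinset, List.mem_filter, decide_eq_true_eq, Set.mem_ofPred_eq] at he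
    exact he.2
  have := (Set.encard_le_encard this).trans hF
  rw [Set.encard_coe_eq_coe_finsetCard] at this
  exact_mod_cast this

/-- Some Hamilton cycle of `G` contains all edges of `F`. -/
def HasHamiltonianCycleThrough (G F : SimpleGraph V) : Prop :=
  ∃ (a : V) (p : G.Walk a a), p.IsHamiltonianCycle ∧ ∀ e ∈ F.edgeSet, e ∈ p.edges

/-- The Ore-type step of the Bondy-Chvátal closure for cycles through a prescribed forest. -/
lemma hasHamiltonianCycleThrough_of_le_degree_add_degree [DecidableRel G.Adj] {F : SimpleGraph V}
    {k : ℕ} (hF : F.edgeSet.encard ≤ k) {u v : V} {q : G.Walk u v} (hq : q.IsHamiltonian)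
    (hFq : ∀ e ∈ F.edgeSet, e ∈ q.edges) (hn : 3 ≤ Fintype.card V)
    (hdeg : Fintype.card V + k ≤ G.degree u + G.degree v) : HasHamiltonianCycleThrough G F := by
  classical
  suffices h : ∃ d ∈ q.darts, G.Adj u d.snd ∧ G.Adj v d.fst ∧ d.edge ∉ F.edgeSet by
    obtain ⟨d, hd, h1, h2, h3⟩ := h
    obtain ⟨p, hp, hpe⟩ := exists_isHamiltonianCycle_of_exchange hq hd h1 h2 hn
    exact ⟨_, p, hp, fun e he => hpe e (hFq e he) fun h => h3 (h ▸ he)⟩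
  by_contra! hcon
  -- The path has n - 1 darts, so at least k + 1 of them satisfy both adjacencies. At most k darts
  -- carry edges of F.
  have h1 := countP_add_countP_le q.darts (fun d => decide (G.Adj u d.snd))
    (fun d => decide (G.Adj v d.fst))
  rw [countP_adj_snd_eq_degree hq, countP_adj_fst_eq_degree hq, Walk.length_darts,
    hq.length_eq] at h1
  have h2 : q.darts.countP (fun d => decide (G.Adj u d.snd) && decide (G.Adj v d.fst)) ≤ k := by
    refine le_trans (List.countP_mono_left fun d hd h => ?_)
      (countP_mem_edgeSet_le hF hq.isPath.isTrail.edges_nodup)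
    simp only [Bool.and_eq_true, decide_eq_true_eq] at h ⊢
    exact hcon d hd h.1 h.2
  omega

/-- Adding one edge to `G`: a Hamilton path between its ends is left when the edge is used. -/
lemma exists_isHamiltonian_of_sup_edge {F : SimpleGraph V} {u v : V}
    (h : HasHamiltonianCycleThrough (G ⊔ edge u v) F) (hG : ¬ HasHamiltonianCycleThrough G F) :
    ∃ q : G.Walk u v, q.IsHamiltonian ∧ ∀ e ∈ F.edgeSet, e ≠ s(u, v) → e ∈ q.edges := by
  obtain ⟨a, p, hp, hpF⟩ := h
  have key : ∀ {x y : V} (w : (G ⊔ edge u v).Walk x y), s(u, v) ∉ w.edges →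
      ∀ e ∈ w.edges, e ∈ G.edgeSet := by
    intro x y w hw e he
    have h1 := w.edges_subset_edgeSet he
    rw [edgeSet_sup] at h1
    rcases h1 with h1 | h1
    · exact h1
    · refine absurd he ?_
      rw [edgeSet_edge] at h1
      have := h1.1
      simp only [Set.mem_singleton_iff] at this
      rwa [this]
  by_cases hmem : s(u, v) ∈ p.edges
  · have hmem' := hmem
    rw [Walk.edges, List.mem_map] at hmem'
    obtain ⟨d, hd, hde⟩ := hmem'
    obtain ⟨q, hq, hperm⟩ := exists_isHamiltonian_of_mem_darts hp hd
    have hnd := hperm.nodup_iff.2 hp.isCycle.isTrail.edges_nodup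
    rw [hde] at hnd hperm
    have hq' := key q (List.nodup_cons.1 hnd).1
    have hHam : (q.transfer G hq').IsHamiltonian := by
      intro x; rw [Walk.support_transfer]; exact hq x
    have hE : ∀ e ∈ F.edgeSet, e ≠ s(u, v) → e ∈ (q.transfer G hq').edges := by
      intro e he hne
      rw [Walk.edges_transfer]
      exact (List.mem_cons.1 (hperm.mem_iff.2 (hpF e he))).resolve_left hne
    have := dart_edge_eq_mk'_iff'.1 hde
    rcases this with ⟨h1, h2⟩ | ⟨h1, h2⟩
    · refine ⟨((q.transfer G hq').copy h2 h1).reverse, ?_, by simpa using hE⟩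
      intro x
      simpa using hHam x
    · exact ⟨(q.transfer G hq').copy h2 h1, fun x => by simpa using hHam x, by simpa using hE⟩
  -- A cycle that avoids the added edge already lives in G.
  · refine absurd ⟨a, p.transfer G (key p hmem), ?_, ?_⟩ hG
    · rw [Walk.isHamiltonianCycle_iff_isCycle_and_length_eq, Walk.length_transfer]
      exact ⟨hp.isCycle.transfer _, hp.length_eq⟩
    · simpa using hpF

end HamiltonWalks
-- Linear forests as lists, and their extension to Hamilton cycles of the complete graph.
section LinearForests

set_option linter.unusedSectionVars false

/-- A consecutive pair cannot straddle w, so a list may be cut at w if w is kept in both pieces. -/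
lemma pair_infix_append_cons {α : Type*} {x y w : α} {A B : List α}
    (h : [x, y] <:+: A ++ w :: B) : [x, y] <:+: A ++ [w] ∨ [x, y] <:+: w :: B := by
  induction A with
  | nil => exact Or.inr h
  | cons a A ih =>
    rw [List.cons_append, List.infix_cons_iff] at h
    rcases h with h | h
    · left
      cases A with
      | nil =>
        simp only [List.nil_append, List.cons_prefix_cons] at h
        obtain ⟨rfl, rfl, -⟩ := h
        exact List.infix_refl _
      | cons b A =>
        simp only [List.cons_append, List.cons_prefix_cons] at h
        obtain ⟨rfl, rfl, -⟩ := h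
        exact ⟨[], A ++ [w], by simp⟩
    · rcases ih h with h | h
      · exact Or.inl (List.infix_cons h)
      · exact Or.inr h

lemma pair_infix_concat {α : Type*} {x y w : α} {A : List α}
    (h : [x, y] <:+: A ++ [w]) : [x, y] <:+: A ∨ (y = w ∧ ∃ A', A = A' ++ [x]) := by
  obtain ⟨P, Q, h⟩ := h
  rcases Q.eq_nil_or_concat with rfl | ⟨Q, z, rfl⟩
  · right
    have h' : (P ++ [x]) ++ [y] = A ++ [w] := by simpa using h
    obtain ⟨h1, h2⟩ := List.append_inj' h' rfl
    exact ⟨by simpa using h2, P, h1.symm⟩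
  · left
    have h' : (P ++ [x, y] ++ Q) ++ [z] = A ++ [w] := by simpa using h
    exact ⟨P, Q, (List.append_inj' h' rfl).1⟩

lemma pair_infix_cons {α : Type*} {x y w : α} {B : List α}
    (h : [x, y] <:+: w :: B) : [x, y] <:+: B ∨ (x = w ∧ ∃ B', B = y :: B') := by
  rw [List.infix_cons_iff] at h
  rcases h with h | h
  · right
    cases B with
    | nil => simp at h
    | cons b B =>
      simp only [List.cons_prefix_cons] at h
      obtain ⟨rfl, rfl, -⟩ := h
      exact ⟨rfl, B, rfl⟩
  · exact Or.inl h

variable {V : Type*}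

/-- The first vertex of a longest path: a second neighbour would prolong the path or close a cycle.
-/
lemma exists_leaf [Finite V] {F : SimpleGraph V} (hF : F.IsAcyclic) (hne : F ≠ ⊥) :
    ∃ v w, F.Adj v w ∧ ∀ x, F.Adj v x → x = w := by
  obtain ⟨a, b, hab⟩ := ne_bot_iff_exists_adj.1 hne
  have : Nonempty V := ⟨a⟩
  have ⟨u, v, p, hp, hmax⟩ := Walk.exists_isPath_forall_isPath_length_le_length F
  have hnil : ¬p.Nil := by
    intro h
    have := hmax a b _ hab.isPath_toWalk
    rw [← Walk.length_eq_zero_iff] at h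
    simp [h] at this
  refine ⟨u, _, p.adj_snd hnil, fun w hadj ↦ ?_⟩
  apply hF.eq_snd_of_adj_start hp hadj
  have : ¬(p.cons hadj.symm).IsPath := by grind [Walk.length_cons]
  grind [hp.cons]

lemma not_three_adj {F : SimpleGraph V} {w a b c : V} (h : (F.neighborSet w).encard ≤ 2)
    (ha : F.Adj w a) (hb : F.Adj w b) (hc : F.Adj w c) (hab : a ≠ b) (hac : a ≠ c)
    (hbc : b ≠ c) : False := by
  have h3 : ({a, b, c} : Set V).encard = 3 := by
    rw [Set.encard_eq_three]; exact ⟨a, b, c, hab, hac, hbc, rfl⟩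
  have hsub : ({a, b, c} : Set V) ⊆ F.neighborSet w := by
    rintro x (rfl | rfl | rfl) <;> assumption
  have := (Set.encard_le_encard hsub).trans h
  rw [h3] at this
  exact absurd this (by decide)

/-- The non-isolated vertices of a linear forest can be listed so that adjacent vertices are
consecutive. -/
lemma IsLinearForest.exists_list [Finite V] (F : SimpleGraph V) (hF : IsLinearForest F) :
    ∃ l : List V, l.Nodup ∧ (∀ v, v ∈ l ↔ ∃ w, F.Adj v w) ∧
      ∀ x y, F.Adj x y → [x, y] <:+: l ∨ [y, x] <:+: l := by
  classical
  induction F using WellFoundedLT.induction with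
  | ind F ih =>
  by_cases hne : F = ⊥
  · exact ⟨[], by simp [hne]⟩
  obtain ⟨v, w, hvw, hv⟩ := exists_leaf hF.1 hne
  let F' : SimpleGraph V :=
    { Adj := fun x y => F.Adj x y ∧ x ≠ v ∧ y ≠ v
      symm := ⟨fun x y h => ⟨h.1.symm, h.2.2, h.2.1⟩⟩
      loopless := ⟨fun x h => F.loopless.irrefl x h.1⟩ }
  have hF' : ∀ x y, F'.Adj x y ↔ F.Adj x y ∧ x ≠ v ∧ y ≠ v := fun _ _ => Iff.rfl
  have hle : F' ≤ F := fun x y h => h.1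
  have hlt : F' < F := lt_of_le_of_ne hle fun h => by
    have := (hF' v w).1 (h ▸ hvw)
    exact this.2.1 rfl
  obtain ⟨l, hnd, hmem, hl⟩ := ih F' hlt ⟨hF.1.anti hle, fun x =>
    (Set.encard_le_encard fun y hy => hle hy).trans (hF.2 x)⟩
  have hvl : v ∉ l := fun h => by obtain ⟨z, hz⟩ := (hmem v).1 h; exact hz.2.1 rfl
  have hwv : w ≠ v := hvw.ne'
  have hmem' : ∀ z, (∃ y, F.Adj z y) ↔ z = v ∨ z = w ∨ z ∈ l := by
    intro z
    rw [hmem]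
    constructor
    · rintro ⟨y, hy⟩
      by_cases h1 : z = v
      · exact Or.inl h1
      by_cases h2 : y = v
      · subst h2; exact Or.inr (Or.inl (hv z hy.symm))
      · exact Or.inr (Or.inr ⟨y, hy, h1, h2⟩)
    · rintro (rfl | rfl | ⟨y, hy⟩)
      · exact ⟨w, hvw⟩
      · exact ⟨v, hvw.symm⟩
      · exact ⟨y, hy.1⟩
  -- It remains to insert the leaf v (and w, if it is missing) next to w without separating adjacent
  -- consecutive vertices.
  have suff : ∀ l' : List V, l'.Nodup → (∀ z, z ∈ l' ↔ z = v ∨ z = w ∨ z ∈ l) →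
      (∀ x y, F'.Adj x y → [x, y] <:+: l → [x, y] <:+: l') →
      ([v, w] <:+: l' ∨ [w, v] <:+: l') →
      ∃ l : List V, l.Nodup ∧ (∀ v, v ∈ l ↔ ∃ w, F.Adj v w) ∧
        ∀ x y, F.Adj x y → [x, y] <:+: l ∨ [y, x] <:+: l := by
    intro l' h1 h2 h3 h4
    refine ⟨l', h1, fun z => by rw [hmem', h2], fun x y hxy => ?_⟩
    by_cases hx : x = v
    · subst hx; rw [hv y hxy]; exact h4
    by_cases hy : y = v
    · subst hy; rw [hv x hxy.symm]; exact h4.symm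
    have hadj : F'.Adj x y := ⟨hxy, hx, hy⟩
    exact (hl x y hadj).imp (h3 x y hadj) (h3 y x hadj.symm)
  by_cases hwl : w ∈ l
  · obtain ⟨A, B, rfl⟩ := List.append_of_mem hwl
    -- If the successor of w is a neighbour, v goes just before w: a neighbour there too would give
    -- w degree three. Otherwise v goes just after w.
    by_cases hB : ∃ z B', B = z :: B' ∧ F'.Adj w z
    · obtain ⟨z, B', rfl, hz⟩ := hB
      apply suff (A ++ v :: w :: z :: B')
      · grind
      · grind
      · intro x y hxy h
        rcases pair_infix_append_cons h with h | h
        · rcases pair_infix_concat h with h | ⟨rfl, A', rfl⟩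
          · exact h.trans (List.prefix_append _ _).isInfix
          · exfalso
            refine not_three_adj (hF.2 y) hvw.symm hxy.symm.1 hz.1 hxy.2.1.symm hz.2.2.symm ?_
            grind
        · exact h.trans ⟨A ++ [v], [], by simp⟩
      · exact Or.inl ⟨A, z :: B', by simp⟩
    · apply suff (A ++ w :: v :: B)
      · grind
      · grind
      · intro x y hxy h
        rcases pair_infix_append_cons h with h | h
        · exact h.trans ⟨[], v :: B, by simp⟩
        · rcases pair_infix_cons h with h | ⟨rfl, B', rfl⟩
          · exact h.trans ⟨A ++ [w, v], [], by simp⟩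
          · exact absurd ⟨y, B', rfl, hxy⟩ hB
      · exact Or.inr ⟨A, B, by simp⟩
  · apply suff (l ++ [w, v])
    · grind
    · grind
    · intro x y _ h
      exact h.trans (List.prefix_append _ _).isInfix
    · exact Or.inr ⟨l, [], by simp⟩

variable [Fintype V] [DecidableEq V]

/-- A linear forest is contained in a Hamilton cycle of the complete graph. -/
lemma IsLinearForest.hasHamiltonianCycleThrough_top {F : SimpleGraph V} (hF : IsLinearForest F)
    (hn : 3 ≤ Fintype.card V) : HasHamiltonianCycleThrough ⊤ F := by
  obtain ⟨l₀, hnd₀, -, hl₀⟩ := IsLinearForest.exists_list F hF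
  obtain ⟨l, hnd, hmem, hl⟩ : ∃ l : List V, l.Nodup ∧ (∀ v, v ∈ l) ∧
      ∀ x y, F.Adj x y → [x, y] <:+: l ∨ [y, x] <:+: l := by
    -- Isolated vertices are appended in any order.
    refine ⟨l₀ ++ (Finset.univ.filter (· ∉ l₀)).toList, ?_, ?_, ?_⟩
    · refine hnd₀.append (Finset.nodup_toList _) ?_
      intro x hx hx'
      simp at hx'
      exact hx' hx
    · intro v
      simp [em]
    · intro x y hxy
      exact (hl₀ x y hxy).imp (fun h => h.trans (List.prefix_append _ _).isInfix)
        (fun h => h.trans (List.prefix_append _ _).isInfix)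
  have hne : l ≠ [] := by
    have : Nonempty V := Fintype.card_pos_iff.1 (by omega)
    exact List.ne_nil_of_mem (hmem (Classical.arbitrary V))
  have hchain : l.IsChain (⊤ : SimpleGraph V).Adj := by
    have : l.Pairwise (· ≠ ·) := hnd
    exact (this.imp (fun h => by simpa using h)).isChain
  have hsupp := Walk.support_ofSupport hne hchain
  have hp : (Walk.ofSupport l hne hchain).IsHamiltonian := by
    rw [isHamiltonian_iff_nodup, hsupp]
    exact ⟨hnd, hmem⟩
  have hlen := hp.length_eq
  generalize Walk.ofSupport l hne hchain = p at *
  have hadj : (⊤ : SimpleGraph V).Adj (l.getLast hne) (l.head hne) := by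
    rw [top_adj]
    intro h
    have := hp.isPath.nil_iff_eq.2 h.symm
    rw [← Walk.length_eq_zero_iff] at this
    omega
  refine ⟨_, _, isHamiltonianCycle_cons hp hadj hn, ?_⟩
  intro e he
  rw [Walk.edges_cons, List.mem_cons]
  right
  induction e with
  | h x y =>
    rw [mem_edgeSet] at he
    have hxy : (⊤ : SimpleGraph V).Adj x y := he.ne
    rw [← hsupp] at hl
    rcases hl x y he with h | h
    · exact List.mem_map.2 ⟨_, (Walk.mem_darts_iff_infix_support hxy).2 h, rfl⟩
    · exact List.mem_map.2 ⟨_, (Walk.mem_darts_iff_infix_support hxy.symm).2 h, Sym2.eq_swap⟩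

end LinearForests
-- From the closure argument to a Chvátal-type degree condition.
section DegreeSequences

variable {V : Type*} [Fintype V]

open Classical in
/-- The number of vertices of degree at most `d`. -/
noncomputable def lowDegreeCount (G : SimpleGraph V) (d : ℕ) : ℕ :=
  (Finset.univ.filter fun v => G.degree v ≤ d).card

/-- The degree condition of Chvátal type which holds when a Hamiltonicity property fails, with
`r = ℓ + 1` and `m = i - 1` in the usual notation. -/
structure DegreeCondition (G : SimpleGraph V) (r m : ℕ) : Prop where
  index_le : 2 * m + r + 2 ≤ Fintype.card V
  low : m + 1 ≤ lowDegreeCount G (m + r)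
  high : Fintype.card V ≤ lowDegreeCount G (Fintype.card V - m - 2) + (m + r)

lemma lowDegreeCount_mono (G : SimpleGraph V) {d e : ℕ} (h : d ≤ e) :
    lowDegreeCount G d ≤ lowDegreeCount G e := by
  classical
  exact Finset.card_le_card (Finset.monotone_filter_right _ fun v _ hv => le_trans hv h)

lemma lowDegreeCount_anti {G G' : SimpleGraph V} (h : G ≤ G') (d : ℕ) :
    lowDegreeCount G' d ≤ lowDegreeCount G d := by
  classical
  exact Finset.card_le_card
    (Finset.monotone_filter_right _ fun v _ hv => le_trans (degree_le_of_le h) hv)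

lemma DegreeCondition.anti {G G' : SimpleGraph V} {r m : ℕ} (h : DegreeCondition G' r m)
    (hG : G ≤ G') : DegreeCondition G r m :=
  ⟨h.1, h.2.trans (lowDegreeCount_anti hG _),
    h.3.trans (Nat.add_le_add_right (lowDegreeCount_anti hG _) _)⟩

/-- Raising r relaxes both counts. If m is too large for s, the largest index m' admissible for s
works, because then m' < m and m + r ≤ m' + s. -/
lemma DegreeCondition.exists_of_le {G : SimpleGraph V} {r s m : ℕ} (h : DegreeCondition G r m)
    (hrs : r ≤ s) (hs : s + 2 ≤ Fintype.card V) : ∃ m', DegreeCondition G s m' := by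
  obtain ⟨h1, h2, h3⟩ := h
  by_cases hm : 2 * m + s + 2 ≤ Fintype.card V
  · exact ⟨m, hm, h2.trans (lowDegreeCount_mono G (by omega)), by omega⟩
  · refine ⟨(Fintype.card V - s - 2) / 2, by omega, ?_, ?_⟩
    · have := lowDegreeCount_mono G (show m + r ≤ (Fintype.card V - s - 2) / 2 + s by omega)
      omega
    · have := lowDegreeCount_mono G (show Fintype.card V - m - 2 ≤
        Fintype.card V - (Fintype.card V - s - 2) / 2 - 2 by omega)
      omega

lemma card_filter_not_adj_add_degree (G : SimpleGraph V) [DecidableRel G.Adj] (u : V) :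
    (Finset.univ.filter fun w => ¬ G.Adj u w).card + G.degree u = Fintype.card V := by
  classical
  rw [← card_neighborFinset_eq_degree, neighborFinset_eq_filter, add_comm,
    Finset.card_filter_add_card_filter_not, Finset.card_univ]

/-- Chvátal's argument: if non-adjacent vertices have small degree sum, then the degree sequence
satisfies the degree condition. -/
lemma exists_degreeCondition_of_degree_add_degree_lt {G : SimpleGraph V} [DecidableRel G.Adj]
    {k : ℕ} (hk : k + 3 ≤ Fintype.card V) (hG : G ≠ ⊤)
    (h : ∀ u v, u ≠ v → ¬ G.Adj u v → G.degree u + G.degree v < Fintype.card V + k) :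
    ∃ m, DegreeCondition G (k + 1) m := by
  classical
  let S : Finset (V × V) := Finset.univ.filter fun p => p.1 ≠ p.2 ∧ ¬ G.Adj p.1 p.2
  have hS : S.Nonempty := by
    by_contra hS
    rw [Finset.not_nonempty_iff_eq_empty] at hS
    -- Without a non-adjacent pair the graph would be complete.
    refine hG (eq_top_iff.2 fun u v huv => ?_)
    by_contra hadj
    have : (u, v) ∈ S := by simp [S, hadj]; exact huv
    simp [hS] at this
  obtain ⟨⟨u, v⟩, huv, hmax⟩ := S.exists_max_image (fun p => G.degree p.1 + G.degree p.2) hS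
  simp only [S, Finset.mem_filter, Finset.mem_univ, true_and, Prod.forall] at huv hmax
  wlog hle : G.degree u ≤ G.degree v generalizing u v
  · refine this v u ⟨huv.1.symm, fun h => huv.2 h.symm⟩ ?_ (by omega)
    intro a b hab
    have := hmax a b hab
    omega
  obtain ⟨hne, hnadj⟩ := huv
  have hsum := h u v hne hnadj
  have hcu := card_filter_not_adj_add_degree G u
  have hcv := card_filter_not_adj_add_degree G v
  -- By maximality of the degree sum of u and v, a non-neighbour of u has degree at most d(v), and a
  -- non-neighbour of v other than v has degree at most d(u).
  have hlow_u : (Finset.univ.filter fun w => ¬ G.Adj u w).card ≤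
      lowDegreeCount G (G.degree v) := by
    refine Finset.card_le_card fun w hw => ?_
    simp only [Finset.mem_filter, Finset.mem_univ, true_and] at hw ⊢
    by_cases hwu : w = u
    · subst hwu; convert hle
    · have := hmax u w ⟨fun h => hwu h.symm, hw⟩
      have h' : G.degree w ≤ G.degree v := by omega
      convert h'
  have hlow_v : (Finset.univ.filter fun w => ¬ G.Adj v w).card ≤
      lowDegreeCount G (G.degree u) + 1 := by
    rw [← Nat.sub_le_iff_le_add, ← Finset.card_erase_of_mem (a := v) (by simp)]
    refine Finset.card_le_card fun w hw => ?_
    simp only [Finset.mem_filter, Finset.mem_univ, true_and, Finset.mem_erase] at hw ⊢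
    have := hmax w v ⟨hw.1, fun h => hw.2 h.symm⟩
    have h' : G.degree w ≤ G.degree u := by omega
    convert h'
  -- The index is chosen so that m + r = d(u). For d(u) ≤ k that would be negative and m = 0 serves,
  -- since v misses u and itself and so d(v) ≤ n - 2.
  by_cases hd : G.degree u ≤ k
  · refine ⟨0, by omega, ?_, ?_⟩
    · refine Finset.card_pos.2 ⟨u, ?_⟩
      simp only [Finset.mem_filter, Finset.mem_univ, true_and]
      have h' : G.degree u ≤ 0 + (k + 1) := by omega
      convert h'
    · have h1 : (Finset.univ.filter fun w => ¬ G.Adj v w).card ≥ 2 := by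
        rw [ge_iff_le, Nat.succ_le_iff, Finset.one_lt_card]
        exact ⟨v, by simp, u, by simpa using fun h => hnadj h.symm, hne.symm⟩
      have := lowDegreeCount_mono G (show G.degree v ≤ Fintype.card V - 0 - 2 by omega)
      omega
  · refine ⟨G.degree u - k - 1, by omega, ?_, ?_⟩
    · rw [show G.degree u - k - 1 + (k + 1) = G.degree u by omega]
      omega
    · have := lowDegreeCount_mono G (show G.degree v ≤
        Fintype.card V - (G.degree u - k - 1) - 2 by omega)
      omega

variable [DecidableEq V]

/-- If some linear forest with at most `k` edges is in no Hamilton cycle, then the degree condition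
holds for some index. -/
theorem exists_degreeCondition {G F : SimpleGraph V} {k : ℕ} (hk : k + 3 ≤ Fintype.card V)
    (hFG : F ≤ G) (hF : IsLinearForest F) (hFk : F.edgeSet.encard ≤ k)
    (hG : ¬ HasHamiltonianCycleThrough G F) : ∃ m, DegreeCondition G (k + 1) m := by
  classical
  -- Maximality makes every added edge create a cycle through F; this replaces iterating the
  -- closure.
  obtain ⟨G', hGG', hmax⟩ :=
    (Set.toFinite {G' : SimpleGraph V | ¬ HasHamiltonianCycleThrough G' F}).exists_le_maximal hG
  have hG' : ¬ HasHamiltonianCycleThrough G' F := hmax.1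
  suffices h : ∃ m, DegreeCondition G' (k + 1) m by
    obtain ⟨m, hm⟩ := h
    exact ⟨m, hm.anti hGG'⟩
  refine exists_degreeCondition_of_degree_add_degree_lt hk ?_ ?_
  · rintro rfl
    exact hG' (hF.hasHamiltonianCycleThrough_top (by omega))
  · intro u v huv hadj
    by_contra! hdeg
    have hadd : HasHamiltonianCycleThrough (G' ⊔ edge u v) F := by
      by_contra hcon
      have hle := hmax.2 (show _ ∈ {G' : SimpleGraph V | ¬ HasHamiltonianCycleThrough G' F}
        from hcon) le_sup_left
      exact hadj (hle (Or.inr (by simp [edge_adj, huv])))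
    obtain ⟨q, hq, hqF⟩ := exists_isHamiltonian_of_sup_edge hadd hG'
    refine hG' (hasHamiltonianCycleThrough_of_le_degree_add_degree hFk hq (fun e he => ?_)
      (by omega) hdeg)
    -- The edge uv is not in F, because F ≤ G ≤ G' and uv is missing from G'.
    refine hqF e he fun h => hadj (hGG' (hFG ?_))
    rw [h, mem_edgeSet] at he
    exact he

end DegreeSequences
-- The cone, which converts Hamilton paths into Hamilton cycles.
section Cone

variable {V : Type*}

/-- The graph obtained from `G` by adding a vertex adjacent to all others. -/
def cone (G : SimpleGraph V) : SimpleGraph (Option V) where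
  Adj x y := match x, y with
    | none, none => False
    | none, some _ => True
    | some _, none => True
    | some a, some b => G.Adj a b
  symm := ⟨by rintro (_ | a) (_ | b) h <;> first | exact h | exact G.symm.symm _ _ h⟩
  loopless := ⟨by rintro (_ | a) h; exacts [h, G.loopless.irrefl _ h]⟩

@[simp] lemma cone_adj_some_some {G : SimpleGraph V} {a b : V} :
    (cone G).Adj (some a) (some b) ↔ G.Adj a b := Iff.rfl

@[simp] lemma cone_adj_none_some {G : SimpleGraph V} {a : V} :
    (cone G).Adj none (some a) := trivial

@[simp] lemma cone_adj_some_none {G : SimpleGraph V} {a : V} :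
    (cone G).Adj (some a) none := trivial

lemma exists_walk_of_cone {G : SimpleGraph V} {a b : Option V} (w : (cone G).Walk a b)
    (h : none ∉ w.support) :
    ∃ (x y : V) (w' : G.Walk x y), a = some x ∧ w.support = w'.support.map some := by
  induction w with
  | @nil u =>
    cases u with
    | none => simp at h
    | some x => exact ⟨x, x, .nil, rfl, by simp⟩
  | @cons u v _ hadj p ih =>
    rw [Walk.support_cons, List.mem_cons, not_or] at h
    obtain ⟨x, y, w', rfl, hw'⟩ := ih h.2
    cases u with
    | none => exact absurd rfl h.1
    | some z =>
      refine ⟨z, y, .cons (cone_adj_some_some.1 hadj) w', rfl, ?_⟩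
      rw [Walk.support_cons, Walk.support_cons, List.map_cons, hw']

variable [Fintype V] [DecidableEq V]

/-- Cutting the cycle at the dart that enters the apex gives a Hamilton path starting there;
dropping the apex leaves one of G. -/
lemma isTraceable_of_cone [Nonempty V] {G : SimpleGraph V}
    (h : HasHamiltonianCycleThrough (cone G) ⊥) : IsTraceable G := by
  obtain ⟨a, p, hp, -⟩ := h
  have hmem : none ∈ p.support.tail := by
    have := (Walk.isHamiltonianCycle_iff_isCycle_and_support_count_tail_eq_one.1 hp).2 none
    exact (@List.count_pos_iff _ instBEqOfDecidableEq _ _ _).1 (this ▸ Nat.one_pos)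
  rw [← Walk.map_snd_darts, List.mem_map] at hmem
  obtain ⟨d, hd, hdn⟩ := hmem
  obtain ⟨q, hq, -⟩ := exists_isHamiltonian_of_mem_darts hp hd
  rw [isHamiltonian_iff_nodup] at hq
  obtain ⟨b, q', hq'⟩ : ∃ (b : Option V) (q' : (cone G).Walk none b), q'.support = q.support :=
    ⟨_, q.copy hdn rfl, by simp⟩
  rw [← hq'] at hq
  cases q' with
  | nil =>
    have := hq.2 (some (Classical.arbitrary V))
    simp at this
  | cons hadj w =>
    rw [Walk.support_cons, List.nodup_cons] at hq
    obtain ⟨x, y, w', -, hw'⟩ := exists_walk_of_cone w hq.1.1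
    rw [hw'] at hq
    refine ⟨x, y, w', isHamiltonian_iff_nodup.2 ⟨hq.1.2.of_map _, fun z => ?_⟩⟩
    simpa using hq.2 (some z)

lemma cone_hasHamiltonianCycleThrough {G : SimpleGraph V} (h : IsTraceable G)
    (hn : 2 ≤ Fintype.card V) : HasHamiltonianCycleThrough (cone G) ⊥ := by
  obtain ⟨a, b, p, hp⟩ := h
  let f : G →g cone G := ⟨some, fun h => h⟩
  have hq : (Walk.cons (cone_adj_none_some (a := a)) (p.map f)).IsHamiltonian := by
    rw [isHamiltonian_iff_nodup] at hp ⊢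
    rw [Walk.support_cons, Walk.support_map]
    refine ⟨List.nodup_cons.2 ⟨by simp [f], hp.1.map (Option.some_injective V)⟩, ?_⟩
    rintro (_ | x)
    · simp
    · exact List.mem_cons_of_mem _ (List.mem_map.2 ⟨x, hp.2 x, rfl⟩)
  exact ⟨_, _, isHamiltonianCycle_cons hq (cone_adj_some_none (a := b))
    (by rw [Fintype.card_option]; omega), by simp⟩

/-- Coning raises every degree by one, and the apex has degree above d + 1, so it is not counted. -/
lemma lowDegreeCount_cone_le {G : SimpleGraph V} {d : ℕ} (hd : d + 1 < Fintype.card V) :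
    lowDegreeCount (cone G) (d + 1) ≤ lowDegreeCount G d := by
  classical
  unfold lowDegreeCount
  rw [← Finset.card_map (s := Finset.univ.filter fun v => G.degree v ≤ d) Function.Embedding.some]
  refine Finset.card_le_card ?_
  rintro (_ | x) hx
  · exfalso
    simp only [Finset.mem_filter, Finset.mem_univ, true_and] at hx
    have : Finset.univ.map (Function.Embedding.some (α := V)) ⊆ (cone G).neighborFinset none := by
      intro y hy
      simp only [Finset.mem_map, Finset.mem_univ, true_and] at hy
      obtain ⟨z, rfl⟩ := hy
      simp
    have := Finset.card_le_card this
    rw [Finset.card_map, Finset.card_univ, card_neighborFinset_eq_degree] at this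
    omega
  · simp only [Finset.mem_filter, Finset.mem_univ, true_and, Finset.mem_map] at hx ⊢
    refine ⟨x, ?_, rfl⟩
    have : insert none ((G.neighborFinset x).map (Function.Embedding.some (α := V))) ⊆
        (cone G).neighborFinset (some x) := by
      intro y hy
      simp only [Finset.mem_map, Finset.mem_insert] at hy
      rcases hy with rfl | ⟨z, hz, rfl⟩
      · simp
      · simpa using hz
    have := Finset.card_le_card this
    rw [Finset.card_insert_of_notMem (by simp), Finset.card_map, card_neighborFinset_eq_degree,
      card_neighborFinset_eq_degree] at this
    omega

end Cone

/-! ### Failure of each of the five properties forces the degree condition. -/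

section DegreeConditions

lemma isLinearForest_bot {V : Type*} : IsLinearForest (⊥ : SimpleGraph V) :=
  ⟨isAcyclic_bot, fun v => by simp⟩

lemma isLinearForest_edge {V : Type*} (a b : V) : IsLinearForest (edge a b) := by
  refine ⟨?_, fun v => ?_⟩
  · have := (isAcyclic_sup_fromEdgeSet_iff (G := (⊥ : SimpleGraph V)) (u := a) (v := b)).2
      ⟨isAcyclic_bot, fun h => Or.inl (by simpa using h)⟩
    simpa using this
  · refine (Set.encard_le_encard (t := {a, b}) ?_).trans ((Set.encard_insert_le _ _).trans_eq (by
      rw [Set.encard_singleton, one_add_one_eq_two]))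
    intro w hw
    rw [mem_neighborSet, edge_adj] at hw
    rcases hw.1 with ⟨-, rfl⟩ | ⟨-, rfl⟩ <;> simp

variable {V : Type*} [Fintype V] [DecidableEq V] {G : SimpleGraph V}

lemma not_hasHamiltonianCycleThrough_bot_of_not_isHamiltonian (h : ¬ G.IsHamiltonian) :
    ¬ HasHamiltonianCycleThrough G ⊥ := by
  rintro ⟨a, p, hp, -⟩
  exact h fun _ => ⟨a, p, hp⟩

lemma exists_degreeCondition_of_not_isHamiltonian (hn : 3 ≤ Fintype.card V)
    (h : ¬ G.IsHamiltonian) : ∃ m, DegreeCondition G 1 m :=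
  exists_degreeCondition (k := 0) (by omega) bot_le isLinearForest_bot (by simp)
    (not_hasHamiltonianCycleThrough_bot_of_not_isHamiltonian h)

/-- The cone satisfies the condition with r = 1 on n + 1 vertices; lowering all degrees by one gives
r = 0. -/
lemma exists_degreeCondition_of_not_isTraceable (hn : 2 ≤ Fintype.card V)
    (h : ¬ IsTraceable G) : ∃ m, DegreeCondition G 0 m := by
  have : Nonempty V := Fintype.card_pos_iff.1 (by omega)
  obtain ⟨m, h1, h2, h3⟩ := exists_degreeCondition (G := cone G) (F := ⊥) (k := 0)
    (by rw [Fintype.card_option]; omega) bot_le isLinearForest_bot (by simp)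
    (fun hc => h (isTraceable_of_cone hc))
  rw [Fintype.card_option] at h1 h3
  refine ⟨m, by omega, ?_, ?_⟩
  · exact h2.trans (lowDegreeCount_cone_le (by omega))
  · have := lowDegreeCount_cone_le (G := G) (d := Fintype.card V - m - 2) (by omega)
    rw [show Fintype.card V + 1 - m - 2 = Fintype.card V - m - 2 + 1 by omega] at h3
    omega

lemma exists_degreeCondition_of_not_isHamiltonianConnected (hn : 4 ≤ Fintype.card V)
    (h : ¬ IsHamiltonianConnected G) : ∃ m, DegreeCondition G 2 m := by
  unfold IsHamiltonianConnected at h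
  push Not at h
  obtain ⟨a, b, hab, hp⟩ := h
  have hmem : s(a, b) ∈ (edge a b).edgeSet := by rw [mem_edgeSet, edge_adj]; simp [hab]
  -- The edge ab is added so that the forest lies in the graph. A Hamilton cycle through ab, cut
  -- there, would be a Hamilton path of G from a to b.
  have hG : ¬ HasHamiltonianCycleThrough (G ⊔ edge a b) (edge a b) := by
    intro hc
    by_cases hG : HasHamiltonianCycleThrough G (edge a b)
    · obtain ⟨c, p, hpH, hpe⟩ := hG
      have := hpe _ hmem
      rw [Walk.edges, List.mem_map] at this
      obtain ⟨d, hd, hde⟩ := this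
      obtain ⟨q, hq, -⟩ := exists_isHamiltonian_of_mem_darts hpH hd
      rcases dart_edge_eq_mk'_iff'.1 hde with ⟨h1, h2⟩ | ⟨h1, h2⟩
      · exact hp (q.copy h2 h1).reverse fun x => by simpa using hq x
      · exact hp (q.copy h2 h1) fun x => by simpa using hq x
    · obtain ⟨q, hq, -⟩ := exists_isHamiltonian_of_sup_edge hc hG
      exact hp q hq
  obtain ⟨m, hm⟩ := exists_degreeCondition (k := 1) (by omega) le_sup_right
    (isLinearForest_edge a b) (by
      refine (Set.encard_le_encard (t := {s(a, b)}) ?_).trans (by simp)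
      rw [edgeSet_edge]; exact Set.sdiff_subset) hG
  exact ⟨m, hm.anti le_sup_left⟩

lemma exists_degreeCondition_of_not_isEdgeHamiltonian {k : ℕ} (hn : k + 3 ≤ Fintype.card V)
    (h : ¬ IsEdgeHamiltonian k G) : ∃ m, DegreeCondition G (k + 1) m := by
  unfold IsEdgeHamiltonian at h
  push Not at h
  obtain ⟨F, hFG, hF, hFk, hc⟩ := h
  refine exists_degreeCondition hn hFG hF hFk ?_
  rintro ⟨a, p, hp, hpe⟩
  obtain ⟨e, he, hne⟩ := hc a p hp
  exact hne (hpe e he)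

/-- Putting S back adds at most |S| to a degree. -/
lemma lowDegreeCount_induce_le (S : Finset V) [Fintype {v | v ∉ S}] (d : ℕ) :
    lowDegreeCount (G.induce {v | v ∉ S}) d ≤ lowDegreeCount G (d + S.card) := by
  classical
  unfold lowDegreeCount
  refine Finset.card_le_card_of_injOn Subtype.val ?_ Subtype.val_injective.injOn
  intro x hx
  simp only [Finset.coe_filter, Finset.mem_univ, true_and, Set.mem_ofPred_eq] at hx ⊢
  have : G.neighborFinset x ⊆
      ((G.induce {v | v ∉ S}).neighborFinset x).map (Function.Embedding.subtype _) ∪ S := by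
    intro y hy
    by_cases hyS : y ∈ S
    · simp [hyS]
    · rw [mem_neighborFinset] at hy
      refine Finset.mem_union_left _ (Finset.mem_map.2 ⟨⟨y, hyS⟩, ?_, rfl⟩)
      simpa using hy
  have := (Finset.card_le_card this).trans (Finset.card_union_le _ _)
  rw [Finset.card_map, card_neighborFinset_eq_degree, card_neighborFinset_eq_degree] at this
  have h2 := this.trans (Nat.add_le_add_right hx _)
  convert h2

lemma exists_degreeCondition_of_not_isVertexHamiltonian {k : ℕ} (hn : k + 3 ≤ Fintype.card V)
    (h : ¬ IsVertexHamiltonian k G) : ∃ m, DegreeCondition G (k + 1) m := by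
  unfold IsVertexHamiltonian at h
  push Not at h
  obtain ⟨S, hSk, hS⟩ := h
  have hcard : Fintype.card {v | v ∉ S} + S.card = Fintype.card V := by
    have h1 : Fintype.card {v | v ∉ S} = (Finset.univ \ S).card := by
      rw [Fintype.card_subtype]; congr 1; ext; simp
    rw [h1, Finset.card_sdiff_add_card_eq_card (Finset.subset_univ _), Finset.card_univ]
  obtain ⟨m, h1, h2, h3⟩ := exists_degreeCondition_of_not_isHamiltonian (by omega) hS
  -- Restoring S turns r = 1 into r = |S| + 1, which is then raised to k + 1.
  refine DegreeCondition.exists_of_le (r := S.card + 1) (m := m) ⟨by omega, ?_, ?_⟩ (by omega)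
    (by omega)
  · exact h2.trans ((lowDegreeCount_induce_le S _).trans (lowDegreeCount_mono G (by omega)))
  · have := (lowDegreeCount_induce_le (G := G) S (Fintype.card {v | v ∉ S} - m - 2)).trans
      (lowDegreeCount_mono G (show _ ≤ Fintype.card V - m - 2 by omega))
    omega

end DegreeConditions
-- Counting stars by centre and leaf set.
section Stars

variable {V : Type*} {G : SimpleGraph V}

/-- `S` is the star with centre `v` and set of leaves `T`. -/
structure IsStar (S : G.Subgraph) (v : V) (T : Finset V) : Prop where
  center_notMem : v ∉ T
  mem_verts : ∀ x, x ∈ S.verts ↔ x = v ∨ x ∈ T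
  adj_iff : ∀ x y, S.Adj x y ↔ (x = v ∧ y ∈ T) ∨ (y = v ∧ x ∈ T)

lemma nonempty_iso_coe_iff {S : G.Subgraph} {t : ℕ} :
    Nonempty (completeBipartiteGraph (Fin 1) (Fin t) ≃g S.coe) ↔
      ∃ (v : V) (T : Finset V), T.card = t ∧ IsStar S v T := by
  classical
  constructor
  · rintro ⟨φ⟩
    let f : Fin 1 ⊕ Fin t → V := fun x => (φ x : V)
    have hf : Function.Injective f := Subtype.val_injective.comp φ.injective
    have hadj : ∀ x y, S.Adj (f x) (f y) ↔ (completeBipartiteGraph (Fin 1) (Fin t)).Adj x y := by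
      intro x y
      rw [← φ.map_adj_iff]
      simp [f]
    have hsurj : ∀ x, x ∈ S.verts → ∃ y, f y = x := fun x hx => by
      obtain ⟨y, hy⟩ := φ.surjective ⟨x, hx⟩
      exact ⟨y, by simp [f, hy]⟩
    refine ⟨f (.inl 0), Finset.univ.image (fun j => f (.inr j)), ?_, ?_, ?_, ?_⟩
    · rw [Finset.card_image_of_injective _ (fun a b h => Sum.inr_injective (hf h)), Finset.card_univ,
        Fintype.card_fin]
    · simp [hf.eq_iff]
    · intro x
      constructor
      · intro hx
        obtain ⟨y, rfl⟩ := hsurj x hx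
        rcases y with i | j
        · rw [Subsingleton.elim i 0]; exact Or.inl rfl
        · exact Or.inr (Finset.mem_image_of_mem _ (Finset.mem_univ j))
      · rintro (rfl | hx)
        · exact (φ (.inl 0)).2
        · obtain ⟨j, -, rfl⟩ := Finset.mem_image.1 hx
          exact (φ (.inr j)).2
    · intro x y
      constructor
      · intro h
        obtain ⟨a, rfl⟩ := hsurj x (S.edge_vert h)
        obtain ⟨b, rfl⟩ := hsurj y (S.edge_vert h.symm)
        rw [hadj] at h
        rcases a with i | i <;> rcases b with j | j
        · simp at h
        · rw [Subsingleton.elim i 0]; simp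
        · rw [Subsingleton.elim j 0]; simp
        · simp at h
      · rintro (⟨rfl, h⟩ | ⟨rfl, h⟩) <;> obtain ⟨j, -, rfl⟩ := Finset.mem_image.1 h <;>
          rw [hadj] <;> simp
  · rintro ⟨v, T, hT, hS⟩
    let e : Fin t ≃ T := (T.equivFinOfCardEq hT).symm
    let f : Fin 1 ⊕ Fin t → S.verts := Sum.elim (fun _ => ⟨v, (hS.mem_verts v).2 (Or.inl rfl)⟩)
      (fun j => ⟨e j, (hS.mem_verts _).2 (Or.inr (e j).2)⟩)
    have hf : Function.Bijective f := by
      constructor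
      · rintro (i | i) (j | j) h
        · rw [Subsingleton.elim i j]
        · simp only [f, Sum.elim_inl, Sum.elim_inr, Subtype.mk.injEq] at h
          exact absurd (h ▸ (e j).2) hS.center_notMem
        · simp only [f, Sum.elim_inl, Sum.elim_inr, Subtype.mk.injEq] at h
          exact absurd (h ▸ (e i).2) hS.center_notMem
        · simp only [f, Sum.elim_inr, Subtype.mk.injEq] at h
          rw [e.injective (Subtype.ext h)]
      · rintro ⟨x, hx⟩
        rcases (hS.mem_verts x).1 hx with rfl | h
        · exact ⟨.inl 0, rfl⟩
        · exact ⟨.inr (e.symm ⟨x, h⟩), by simp [f]⟩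
    refine ⟨⟨Equiv.ofBijective f hf, ?_⟩⟩
    have hne : ∀ j, (e j : V) ≠ v := fun j h => hS.center_notMem (h ▸ (e j).2)
    rintro (i | i) (j | j) <;>
      simp [f, hS.adj_iff, hS.center_notMem, hne]

/-- The star with centre `v` and leaves `T`, as a subgraph. -/
def starSubgraph (v : V) (T : Finset V) (h : ∀ w ∈ T, G.Adj v w) : G.Subgraph where
  verts := {x | x = v ∨ x ∈ T}
  Adj x y := (x = v ∧ y ∈ T) ∨ (y = v ∧ x ∈ T)
  adj_sub := by
    rintro x y (⟨rfl, hy⟩ | ⟨rfl, hx⟩)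
    · exact h y hy
    · exact (h x hx).symm
  edge_vert := by
    rintro x y (⟨rfl, hy⟩ | ⟨rfl, hx⟩)
    · exact Or.inl rfl
    · exact Or.inr hx
  symm := ⟨fun x y h => h.symm⟩

lemma isStar_starSubgraph (v : V) (T : Finset V) (h : ∀ w ∈ T, G.Adj v w) :
    IsStar (starSubgraph v T h) v T :=
  ⟨fun hv => G.loopless.irrefl v (h v hv), fun _ => Iff.rfl, fun _ _ => Iff.rfl⟩

lemma IsStar.ext {S S' : G.Subgraph} {v : V} {T : Finset V} (h : IsStar S v T)
    (h' : IsStar S' v T) : S = S' := by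
  refine Subgraph.ext ?_ ?_
  · ext x; rw [h.mem_verts, h'.mem_verts]
  · ext x y; rw [h.adj_iff, h'.adj_iff]

lemma IsStar.adj_of_mem {S : G.Subgraph} {v : V} {T : Finset V} (h : IsStar S v T) {w : V}
    (hw : w ∈ T) : G.Adj v w :=
  S.adj_sub ((h.adj_iff v w).2 (Or.inl ⟨rfl, hw⟩))

/-- If the centres differed, every leaf of S would have to be the other centre, which two leaves
exclude. A single edge has two possible centres. -/
lemma IsStar.unique {S : G.Subgraph} {v v' : V} {T T' : Finset V} (h : IsStar S v T)
    (h' : IsStar S v' T') (hT : 2 ≤ T.card) : v = v' ∧ T = T' := by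
  have hv : v = v' := by
    by_contra hne
    obtain ⟨a, ha, b, hb, hab⟩ := Finset.one_lt_card.1 hT
    have key : ∀ a ∈ T, a = v' := fun a ha => by
      rcases (h'.adj_iff v a).1 ((h.adj_iff v a).2 (Or.inl ⟨rfl, ha⟩)) with h1 | h1
      · exact absurd h1.1 hne
      · exact h1.1
    exact hab ((key a ha).trans (key b hb).symm)
  subst hv
  refine ⟨rfl, ?_⟩
  ext x
  have h1 := h.adj_iff v x
  have h2 := h'.adj_iff v x
  have h3 := h.center_notMem
  have h4 := h'.center_notMem
  grind

variable [Fintype V]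

/-- Every star is counted once in `∑ v, (d(v)).choose t`, except that edges are counted twice. -/
def starMultiplicity (t : ℕ) : ℕ := if t = 1 then 2 else 1

lemma starMultiplicity_pos (t : ℕ) : 0 < starMultiplicity t := by
  unfold starMultiplicity; split_ifs <;> norm_num

lemma starCount_eq_ncard (t : ℕ) :
    starCount t G = {S : G.Subgraph | ∃ v T, T.card = t ∧ IsStar S v T}.ncard := by
  classical
  rw [starCount, copyCount, ← Set.ncard_coe_finset]
  congr 1
  ext S
  simp [nonempty_iso_coe_iff]

lemma starCount_one [DecidableRel G.Adj] : starCount 1 G = G.edgeFinset.card := by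
  classical
  rw [starCount_eq_ncard, ← Set.ncard_coe_finset]
  symm
  refine Set.ncard_congr (fun e he =>
    { verts := {x | x ∈ e}
      Adj := fun x y => s(x, y) = e
      adj_sub := fun {x y} h => by rw [← mem_edgeSet, h]; exact mem_edgeFinset.1 he
      edge_vert := fun {x y} h => by rw [← h]; exact Sym2.mem_mk_left x y
      symm := ⟨fun x y h => by rw [Sym2.eq_swap]; exact h⟩ }) ?_ ?_ ?_
  · intro e he
    induction e with
    | h a b =>
      have hab : a ≠ b := (mem_edgeFinset.1 he).ne
      refine ⟨a, {b}, rfl, by simpa using hab, by simp, fun x y => ?_⟩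
      simp only [Sym2.eq_iff, Finset.mem_singleton]
      tauto
  · intro e e' he he' h
    have hadj := congrArg Subgraph.Adj h
    induction e with
    | h a b =>
      have := congrFun (congrFun hadj a) b
      simpa using this
  · intro S hS
    obtain ⟨v, T, hT, hS⟩ := hS
    obtain ⟨w, rfl⟩ := Finset.card_eq_one.1 hT
    refine ⟨s(v, w), mem_edgeFinset.2 (hS.adj_of_mem (by simp)), ?_⟩
    refine Subgraph.ext ?_ ?_
    · ext x
      rw [hS.mem_verts]
      simp
    · ext x y
      rw [hS.adj_iff]
      simp only [Sym2.eq_iff, Finset.mem_singleton]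
      tauto

lemma starCount_of_two_le [DecidableRel G.Adj] {t : ℕ} (ht : 2 ≤ t) :
    starCount t G = ∑ v, (G.degree v).choose t := by
  classical
  have hcard : (Finset.univ.sigma fun v => (G.neighborFinset v).powersetCard t).card =
      ∑ v, (G.degree v).choose t := by
    rw [Finset.card_sigma]
    simp [Finset.card_powersetCard]
  have hX : ∀ {x : (_ : V) × Finset V},
      x ∈ (Finset.univ.sigma fun v => (G.neighborFinset v).powersetCard t) ↔
        (∀ w ∈ x.2, G.Adj x.1 w) ∧ x.2.card = t := by
    intro x
    simp [Finset.mem_powersetCard, Finset.subset_iff]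
  rw [← hcard]
  rw [starCount_eq_ncard, ← Set.ncard_coe_finset]
  symm
  refine Set.ncard_congr (fun x hx => starSubgraph x.1 x.2 (hX.1 hx).1) ?_ ?_ ?_
  · intro x hx
    exact ⟨x.1, x.2, (hX.1 hx).2, isStar_starSubgraph _ _ _⟩
  · rintro ⟨v, T⟩ ⟨v', T'⟩ hx hx' h
    have h1 := isStar_starSubgraph v T (hX.1 hx).1
    have h2 := isStar_starSubgraph v' T' (hX.1 hx').1
    simp only at h
    rw [h] at h1
    obtain ⟨rfl, rfl⟩ := h1.unique h2 (by rw [(hX.1 hx).2]; exact ht)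
    rfl
  · intro S hS
    obtain ⟨v, T, hT, hS⟩ := hS
    exact ⟨⟨v, T⟩, hX.2 ⟨fun w hw => hS.adj_of_mem hw, hT⟩,
      (isStar_starSubgraph v T _).ext hS⟩

lemma starMultiplicity_mul_starCount (G : SimpleGraph V) [DecidableRel G.Adj] {t : ℕ}
    (ht : 1 ≤ t) : starMultiplicity t * starCount t G = ∑ v, (G.degree v).choose t := by
  classical
  rcases ht.eq_or_lt with rfl | ht
  · rw [starCount_one, starMultiplicity, if_pos rfl, ← sum_degrees_eq_twice_card_edges]
    simp
  · rw [starCount_of_two_le ht, starMultiplicity, if_neg (by omega), one_mul]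

lemma starCount_congr {W : Type*} [Fintype W] {H : SimpleGraph W} (e : G ≃g H) {t : ℕ}
    (ht : 1 ≤ t) : starCount t G = starCount t H := by
  classical
  refine Nat.eq_of_mul_eq_mul_left (starMultiplicity_pos t) ?_
  rw [starMultiplicity_mul_starCount G ht, starMultiplicity_mul_starCount H ht]
  exact Fintype.sum_equiv e.toEquiv _ _ fun v => by
    have := e.degree_eq v
    exact congrArg (fun d => d.choose t) this.symm

end Stars
-- Star counts of the extremal graphs, and convexity in the index.
section ExtremalCount

/-- The graph `K_a + (I_b ∪ K_c)`. -/
def blockGraph (a b c : ℕ) : SimpleGraph (Fin a ⊕ (Fin b ⊕ Fin c)) :=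
  join (completeGraph (Fin a)) (emptyGraph (Fin b) ⊕g completeGraph (Fin c))

section Adjacency

variable {a b c : ℕ}

@[simp] lemma blockGraph_adj_inl_inl {x y : Fin a} :
    (blockGraph a b c).Adj (.inl x) (.inl y) ↔ x ≠ y := by
  simp [blockGraph, join]

@[simp] lemma blockGraph_adj_inl_inr {x : Fin a} {y : Fin b ⊕ Fin c} :
    (blockGraph a b c).Adj (.inl x) (.inr y) := by
  simp [blockGraph, join]

@[simp] lemma blockGraph_adj_inr_inl {x : Fin a} {y : Fin b ⊕ Fin c} :
    (blockGraph a b c).Adj (.inr y) (.inl x) := by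
  simp [blockGraph, join]

@[simp] lemma blockGraph_adj_inr_inl_inr {x : Fin b} {y : Fin b ⊕ Fin c} :
    ¬ (blockGraph a b c).Adj (.inr (.inl x)) (.inr y) := by
  rcases y with y | y <;> simp [blockGraph, join]

@[simp] lemma blockGraph_adj_inr_inr_inr_inl {x : Fin c} {y : Fin b} :
    ¬ (blockGraph a b c).Adj (.inr (.inr x)) (.inr (.inl y)) := by
  simp [blockGraph, join]

@[simp] lemma blockGraph_adj_inr_inr {x y : Fin c} :
    (blockGraph a b c).Adj (.inr (.inr x)) (.inr (.inr y)) ↔ x ≠ y := by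
  simp [blockGraph, join]

end Adjacency

lemma starMultiplicity_mul_starCount_blockGraph (a b c : ℕ) {t : ℕ} (ht : 1 ≤ t) :
    starMultiplicity t * starCount t (blockGraph a b c) =
      a * (a + b + c - 1).choose t + b * a.choose t + c * (a + c - 1).choose t := by
  classical
  have key : ∀ {k : ℕ} (x : Fin k), (∑ y : Fin k, if x ≠ y then 1 else 0) = k - 1 := by
    intro k x
    rw [← Finset.card_filter, Finset.filter_ne, Finset.card_erase_of_mem (Finset.mem_univ x),
      Finset.card_univ, Fintype.card_fin]
  have hdeg : ∀ x, (blockGraph a b c).degree x =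
      ∑ y, if (blockGraph a b c).Adj x y then 1 else 0 := by
    intro x
    rw [← card_neighborFinset_eq_degree, neighborFinset_eq_filter, Finset.card_filter]
  have h1 : ∀ x : Fin a, (blockGraph a b c).degree (.inl x) = a + b + c - 1 := by
    intro x
    have := x.pos
    rw [hdeg]
    simp only [Fintype.sum_sum_type, blockGraph_adj_inl_inl, blockGraph_adj_inl_inr, key]
    simp
    omega
  have h2 : ∀ x : Fin b, (blockGraph a b c).degree (.inr (.inl x)) = a := by
    intro x
    rw [hdeg]
    simp only [Fintype.sum_sum_type, blockGraph_adj_inr_inl, blockGraph_adj_inr_inl_inr]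
    simp
  have h3 : ∀ x : Fin c, (blockGraph a b c).degree (.inr (.inr x)) = a + c - 1 := by
    intro x
    have := x.pos
    rw [hdeg]
    simp only [Fintype.sum_sum_type, blockGraph_adj_inr_inl, blockGraph_adj_inr_inr_inr_inl,
      blockGraph_adj_inr_inr, key]
    simp
    omega
  rw [starMultiplicity_mul_starCount _ ht, Fintype.sum_sum_type, Fintype.sum_sum_type]
  simp only [h1, h2, h3]
  simp [add_assoc]

/-- Passing to r = ℓ + 1 and m = i - 1 keeps all parameters natural, including ℓ = -1. -/
lemma starCount_extremalGraph_eq {n r m t : ℕ} {ℓ i : ℤ} (hℓ : ℓ + 1 = r) (hi : i = m + 1)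
    (h : 2 * m + r + 2 ≤ n) :
    starCount t (extremalGraph n ℓ i) =
      starCount t (blockGraph (m + r) (m + 1) (n - 2 * m - r - 1)) := by
  have h1 : m + r = (i + ℓ).toNat := by omega
  have h2 : m + 1 = i.toNat := by omega
  have h3 : n - 2 * m - r - 1 = (n - 2 * i - ℓ).toNat := by omega
  rw [h1, h2, h3]
  rfl

/-- `∑ v, (d(v)).choose t` for the extremal graph with parameters `ℓ = r - 1` and `i = m + 1`. -/
def extremalSum (n r t m : ℕ) : ℕ :=
  (m + r) * (n - 1).choose t + (m + 1) * (m + r).choose t +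
    (n - 2 * m - r - 1) * (n - m - 2).choose t

lemma starMultiplicity_mul_starCount_extremalGraph {n r m t : ℕ} {ℓ i : ℤ} (ht : 1 ≤ t)
    (hℓ : ℓ + 1 = r) (hi : i = m + 1) (h : 2 * m + r + 2 ≤ n) :
    starMultiplicity t * starCount t (extremalGraph n ℓ i) = extremalSum n r t m := by
  rw [starCount_extremalGraph_eq hℓ hi h, starMultiplicity_mul_starCount_blockGraph _ _ _ ht,
    extremalSum, show m + r + (m + 1) + (n - 2 * m - r - 1) - 1 = n - 1 by omega,
    show m + r + (n - 2 * m - r - 1) - 1 = n - m - 2 by omega]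

lemma DegreeCondition.sum_choose_le {V : Type*} [Fintype V] {G : SimpleGraph V}
    [DecidableRel G.Adj] {r m : ℕ} (h : DegreeCondition G r m) (t : ℕ) :
    ∑ v, (G.degree v).choose t ≤ extremalSum (Fintype.card V) r t m := by
  classical
  obtain ⟨h1, h2, h3⟩ := h
  have hlow : ∀ d, lowDegreeCount G d = (Finset.univ.filter fun v => G.degree v ≤ d).card := by
    intro d; unfold lowDegreeCount; congr!
  rw [hlow] at h2 h3
  -- Three layers: I has m + 1 vertices of degree at most m + r, J adds vertices of degree at most n
  -- - m - 2, and the m + r left have degree at most n - 1. These are the degrees in the extremal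
  -- graph.
  obtain ⟨I, hI, hIc⟩ := Finset.exists_subset_card_eq h2
  obtain ⟨J, hIJ, hJ, hJc⟩ := Finset.exists_subsuperset_card_eq
    (s := I) (t := Finset.univ.filter fun v => G.degree v ≤ Fintype.card V - m - 2)
    (n := Fintype.card V - (m + r))
    (hI.trans (Finset.monotone_filter_right _ fun v _ hv => le_trans hv (by omega)))
    (by omega) (by omega)
  have hsum : ∀ (s : Finset V) (d : ℕ), (∀ v ∈ s, G.degree v ≤ d) →
      ∑ v ∈ s, (G.degree v).choose t ≤ s.card * d.choose t := by
    intro s d hs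
    have := Finset.sum_le_card_nsmul s (fun v => (G.degree v).choose t) (d.choose t)
      fun v hv => Nat.choose_le_choose t (hs v hv)
    simpa using this
  have e1 := hsum I (m + r) fun v hv => (Finset.mem_filter.1 (hI hv)).2
  have e2 := hsum (J \ I) (Fintype.card V - m - 2) fun v hv =>
    (Finset.mem_filter.1 (hJ (Finset.mem_sdiff.1 hv).1)).2
  have e3 := hsum (Finset.univ \ J) (Fintype.card V - 1) fun v _ => by
    have := G.degree_lt_card_verts v
    omega
  rw [Finset.card_sdiff_of_subset hIJ, hJc, hIc, show Fintype.card V - (m + r) - (m + 1) =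
    Fintype.card V - 2 * m - r - 1 by omega] at e2
  rw [Finset.card_sdiff_of_subset (Finset.subset_univ J), hJc, Finset.card_univ,
    show Fintype.card V - (Fintype.card V - (m + r)) = m + r by omega] at e3
  rw [hIc] at e1
  rw [← Finset.sum_sdiff (Finset.subset_univ J), ← Finset.sum_sdiff hIJ, extremalSum]
  omega

/-- By Pascal's rule the first differences are the non-decreasing numbers `p.choose (t - 1)`. -/
lemma two_mul_choose_succ_le (p : ℕ) {t : ℕ} (ht : 1 ≤ t) :
    2 * (p + 1).choose t ≤ p.choose t + (p + 2).choose t := by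
  obtain ⟨s, rfl⟩ := Nat.exists_eq_add_of_le' ht
  have h1 := Nat.choose_succ_succ p s
  have h2 := Nat.choose_succ_succ (p + 1) s
  have h3 := Nat.choose_le_choose s (show p ≤ p + 1 by omega)
  simp only [Nat.succ_eq_add_one, add_assoc, one_add_one_eq_two] at h1 h2
  omega

lemma extremalSum_convex {n r t m : ℕ} (ht : 1 ≤ t) (h : 2 * (m + 2) + r + 2 ≤ n) :
    2 * extremalSum n r t (m + 1) ≤ extremalSum n r t m + extremalSum n r t (m + 2) := by
  obtain ⟨c, rfl⟩ := Nat.exists_eq_add_of_le h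
  unfold extremalSum
  rw [show 2 * (m + 2) + r + 2 + c - 2 * (m + 1) - r - 1 = c + 3 by omega,
    show 2 * (m + 2) + r + 2 + c - 2 * m - r - 1 = c + 5 by omega,
    show 2 * (m + 2) + r + 2 + c - 2 * (m + 2) - r - 1 = c + 1 by omega,
    show 2 * (m + 2) + r + 2 + c - m - 2 = m + r + c + 2 + 2 by omega,
    show 2 * (m + 2) + r + 2 + c - (m + 1) - 2 = m + r + c + 2 + 1 by omega,
    show 2 * (m + 2) + r + 2 + c - (m + 2) - 2 = m + r + c + 2 by omega,
    show m + 1 + r = m + r + 1 by omega, show m + 2 + r = m + r + 2 by omega]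
  have a1 := two_mul_choose_succ_le (m + r) ht
  have a2 := Nat.choose_le_choose t (show m + r + 1 ≤ m + r + 2 by omega)
  have b1 := two_mul_choose_succ_le (m + r + c + 2) ht
  have b2 := Nat.choose_le_choose t (show m + r + c + 2 + 1 ≤ m + r + c + 2 + 2 by omega)
  generalize (m + r).choose t = x at *
  generalize (m + r + 1).choose t = y at *
  generalize (m + r + 2).choose t = z at *
  generalize (m + r + c + 2).choose t = x' at *
  generalize (m + r + c + 2 + 1).choose t = y' at *
  generalize (m + r + c + 2 + 2).choose t = z' at *
  -- The second difference of the sum is (m + 1)(x - 2y + z) + 2(z - y) + (c + 1)(x' - 2y' + z') +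
  -- 4(z' - y'); the term in n - 1 is linear in m.
  have a3 := Nat.mul_le_mul_left (m + 1) a1
  have b3 := Nat.mul_le_mul_left (c + 1) b1
  nlinarith

lemma le_max_of_convex {f : ℕ → ℕ} {M : ℕ}
    (hf : ∀ m, m + 2 ≤ M → 2 * f (m + 1) ≤ f m + f (m + 2)) {m : ℕ} (hm : m ≤ M) :
    f m ≤ max (f 0) (f M) := by
  -- Either f does not rise before m, or a rise before m persists up to M by convexity.
  by_cases hdec : ∀ j < m, f (j + 1) ≤ f j
  · refine le_max_of_le_left ?_
    clear hm
    induction m with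
    | zero => exact le_rfl
    | succ m ih => exact (hdec m (by omega)).trans (ih fun j hj => hdec j (by omega))
  · push Not at hdec
    obtain ⟨j, hj, hlt⟩ := hdec
    have hstep : ∀ k, j ≤ k → k + 1 ≤ M → f k < f (k + 1) := by
      intro k hk
      induction k, hk using Nat.le_induction with
      | base => exact fun _ => hlt
      | succ k hk ih =>
        intro hkM
        have h1 := ih (by omega)
        have h2 := hf k (by omega)
        rw [add_assoc, one_add_one_eq_two]
        omega
    refine le_max_of_le_right ?_
    induction M, hm using Nat.le_induction with
    | base => exact le_rfl
    | succ M hM ih =>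
      exact (ih (fun m h => hf m (by omega)) (fun k h1 h2 => hstep k h1 (by omega))).trans
        (hstep M (by omega) le_rfl).le

/-- The degree condition forces the bound on the number of stars. -/
theorem DegreeCondition.starCount_le {V : Type*} [Fintype V] {G : SimpleGraph V} {r m t n : ℕ}
    (h : DegreeCondition G r m) (hn : Fintype.card V = n) (ht : 1 ≤ t) {ℓ : ℤ} (hℓ : ℓ + 1 = r) :
    starCount t G ≤ max (starCount t (extremalGraph n ℓ 1))
      (starCount t (extremalGraph n ℓ (topIndex n ℓ))) := by
  classical
  have hm := h.index_le
  rw [hn] at hm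
  obtain ⟨M, hM⟩ : ∃ M : ℕ, topIndex n ℓ = M + 1 :=
    ⟨(n - r) / 2 - 1, by unfold topIndex; omega⟩
  have hM1 : 2 * M + r + 2 ≤ n := by unfold topIndex at hM; omega
  have hM2 : m ≤ M := by unfold topIndex at hM; omega
  -- Multiplying by the multiplicity treats t = 1 together with t ≥ 2.
  refine Nat.le_of_mul_le_mul_left ?_ (starMultiplicity_pos t)
  rw [← Nat.mul_max_mul_left, starMultiplicity_mul_starCount G ht,
    starMultiplicity_mul_starCount_extremalGraph (m := 0) ht hℓ (by simp) (by omega),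
    starMultiplicity_mul_starCount_extremalGraph ht hℓ hM hM1]
  refine (h.sum_choose_le t).trans ?_
  rw [hn]
  exact le_max_of_convex (fun j hj => extremalSum_convex ht (by omega)) hM2

end ExtremalCount
-- The extremal graphs fail each property.
section Tightness

set_option linter.unusedSectionVars false

/-- The forest is a path through all of A; the vertex a is the end where the induction attaches the
next vertex. -/
lemma exists_isLinearForest_of_nonempty {V : Type*} {A : Finset V} (hA : A.Nonempty) :
    ∃ (F : SimpleGraph V) (a : V), a ∈ A ∧ IsLinearForest F ∧ (∀ x y, F.Adj x y → x ∈ A) ∧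
      F.edgeSet.encard + 1 = A.card ∧ (F.neighborSet a).encard ≤ 1 := by
  classical
  induction hA using Finset.Nonempty.cons_induction with
  | singleton a => exact ⟨⊥, a, by simp, isLinearForest_bot, by simp, by simp, by simp⟩
  | cons b A hb hA ih =>
    obtain ⟨F, a, ha, hF, hFA, hFe, hFa⟩ := ih
    have hab : a ≠ b := fun h => hb (h ▸ ha)
    have hiso : ∀ x, ¬ F.Adj b x := fun x h => hb (hFA b x h)
    have hadj : ∀ x y, (F ⊔ edge a b).Adj x y ↔
        F.Adj x y ∨ (x = a ∧ y = b) ∨ (x = b ∧ y = a) := by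
      intro x y
      rw [sup_adj, edge_adj]
      grind
    refine ⟨F ⊔ edge a b, b, by simp, ⟨?_, ?_⟩, ?_, ?_, ?_⟩
    · refine hF.1.sup_edge_of_not_reachable fun h => ?_
      obtain ⟨p⟩ := h.symm
      cases p with
      | nil => exact hab rfl
      | cons h' _ => exact hiso _ h'
    · intro v
      by_cases hva : v = a
      · subst hva
        have : (F ⊔ edge v b).neighborSet v ⊆ insert b (F.neighborSet v) := by
          intro y hy
          rw [mem_neighborSet, hadj] at hy
          simp only [Set.mem_insert_iff, mem_neighborSet]
          grind
        refine (Set.encard_le_encard this).trans ((Set.encard_insert_le _ _).trans ?_)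
        rw [← one_add_one_eq_two]
        gcongr
      · by_cases hvb : v = b
        · subst hvb
          have : (F ⊔ edge a v).neighborSet v ⊆ {a} := by
            intro y hy
            rw [mem_neighborSet, hadj] at hy
            have := hiso y
            simp only [Set.mem_singleton_iff]
            grind
          refine (Set.encard_le_encard this).trans ?_
          rw [Set.encard_singleton]
          decide
        · have : (F ⊔ edge a b).neighborSet v ⊆ F.neighborSet v := by
            intro y hy
            rw [mem_neighborSet, hadj] at hy
            rw [mem_neighborSet]
            grind
          exact (Set.encard_le_encard this).trans (hF.2 v)
    · intro x y h
      rw [hadj] at h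
      have := hFA x y
      rw [Finset.mem_cons]
      grind
    · have : (F ⊔ edge a b).edgeSet = insert s(a, b) F.edgeSet := by
        ext e
        induction e with
        | h x y =>
          rw [mem_edgeSet, hadj, Set.mem_insert_iff, mem_edgeSet, Sym2.eq_iff]
          tauto
      have hnot : s(a, b) ∉ F.edgeSet := fun h => hiso a (F.symm.symm _ _ h)
      rw [this, Set.encard_insert_of_notMem hnot, hFe,
        Finset.card_cons]
      push_cast
      rfl
    · have : (F ⊔ edge a b).neighborSet b ⊆ {a} := by
        intro y hy
        rw [mem_neighborSet, hadj] at hy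
        have := hiso y
        simp only [Set.mem_singleton_iff]
        grind
      exact (Set.encard_le_encard this).trans (by rw [Set.encard_singleton])

lemma countP_add_countP_add_countP_le {α : Type*} (l : List α) (P Q R S : α → Bool)
    (hP : ∀ x ∈ l, P x → S x) (hQ : ∀ x ∈ l, Q x → S x) (hR : ∀ x ∈ l, R x → S x)
    (hPQ : ∀ x, P x → ¬ Q x) (hPR : ∀ x, P x → ¬ R x) (hQR : ∀ x, Q x → ¬ R x) :
    l.countP P + l.countP Q + l.countP R ≤ l.countP S := by
  induction l with
  | nil => simp
  | cons x l ih =>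
    have := ih (fun y hy => hP y (by simp [hy])) (fun y hy => hQ y (by simp [hy]))
      (fun y hy => hR y (by simp [hy]))
    have h1 := hP x (by simp)
    have h2 := hQ x (by simp)
    have h3 := hR x (by simp)
    have h4 := hPQ x
    have h5 := hPR x
    have h6 := hQR x
    simp only [List.countP_cons]
    cases hp : P x <;> cases hq : Q x <;> cases hr : R x <;> cases hs : S x <;> simp_all <;> omega

variable {V : Type*} [Fintype V] [DecidableEq V] {G : SimpleGraph V}

lemma countP_snd_eq_card {a : V} {p : G.Walk a a} (hp : p.IsHamiltonianCycle) (A : Finset V) :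
    p.darts.countP (fun d => decide (d.snd ∈ A)) = A.card := by
  have h := (Walk.isHamiltonianCycle_iff_isCycle_and_support_count_tail_eq_one.1 hp)
  have h2 := countP_eq_card_filter h.1.support_nodup
    (fun x => List.count_pos_iff.1 (h.2 x ▸ Nat.one_pos)) (· ∈ A)
  rw [← Walk.map_snd_darts, List.countP_map, Finset.filter_univ_mem] at h2
  exact h2

lemma countP_fst_eq_card {a : V} {p : G.Walk a a} (hp : p.IsHamiltonianCycle) (A : Finset V) :
    p.darts.countP (fun d => decide (d.fst ∈ A)) = A.card := by
  rw [← countP_snd_eq_card hp A]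
  have h := congrArg (List.countP fun x => decide (x ∈ A))
    ((Walk.map_fst_darts_append p).trans (Walk.cons_map_snd_darts p).symm)
  rw [List.countP_append, List.countP_cons, List.countP_cons, List.countP_map,
    List.countP_map] at h
  simpa [Function.comp_def] using h

/-- A set `I` of vertices with all neighbours in `A`, a forest inside `A` with at least
`|A| - |I|` edges and a vertex outside `A ∪ I` exclude a Hamilton cycle through the forest. -/
lemma not_hasHamiltonianCycleThrough {F : SimpleGraph V} {A I : Finset V} {k : ℕ}
    (hAI : Disjoint A I) (hI : ∀ x ∈ I, ∀ y, G.Adj x y → y ∈ A) (hIne : I.Nonempty)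
    (hB : ∃ b, b ∉ A ∧ b ∉ I) (hF : ∀ x y, F.Adj x y → x ∈ A) (hk : k ≤ F.edgeSet.encard)
    (hcard : A.card ≤ I.card + k) : ¬ HasHamiltonianCycleThrough G F := by
  rintro ⟨a, p₀, hp₀, hpF₀⟩
  obtain ⟨x, hx⟩ := hIne
  obtain ⟨b, hbA, hbI⟩ := hB
  -- The cycle is rotated to start in I, so that on its way to b it must leave A ∪ I.
  obtain ⟨p, hp, hpF⟩ : ∃ p : G.Walk x x, p.IsHamiltonianCycle ∧ ∀ e ∈ F.edgeSet, e ∈ p.edges :=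
    ⟨p₀.rotate x (hp₀.mem_support x), hp₀.rotate _, fun e he =>
      ((p₀.rotate_edges x (hp₀.mem_support x)).mem_iff).2 (hpF₀ e he)⟩
  have h1 := countP_fst_eq_card hp A
  have h2 := countP_snd_eq_card hp I
  have h3 : k ≤ p.darts.countP fun d => decide (d.fst ∈ A) && decide (d.snd ∈ A) := by
    have hsub : F.edgeSet ⊆ (((p.darts.filter fun d => decide (d.fst ∈ A) &&
        decide (d.snd ∈ A)).map Dart.edge).toFinset : Set (Sym2 V)) := by
      intro e he
      have hmem := hpF e he
      rw [Walk.edges, List.mem_map] at hmem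
      obtain ⟨d, hd, rfl⟩ := hmem
      have hd' : F.Adj d.fst d.snd := he
      simp only [List.coe_toFinset, Set.mem_ofPred_eq, List.mem_map, List.mem_filter]
      exact ⟨d, ⟨hd, by simp [hF _ _ hd', hF _ _ hd'.symm]⟩, rfl⟩
    have := hk.trans (Set.encard_le_encard hsub)
    rw [Set.encard_coe_eq_coe_finsetCard] at this
    have := (Nat.cast_le.1 this).trans (List.toFinset_card_le _)
    rwa [List.length_map, ← List.countP_eq_length_filter] at this
  -- Darts leaving A are split by their heads: in I (all |I| darts into I come from A), in A (at
  -- least k), or outside both.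
  have h4 := countP_add_countP_add_countP_le p.darts
    (fun d => decide (d.snd ∈ I)) (fun d => decide (d.fst ∈ A) && decide (d.snd ∈ A))
    (fun d => decide (d.fst ∈ A) && (decide (d.snd ∉ A) && decide (d.snd ∉ I)))
    (fun d => decide (d.fst ∈ A))
    (fun d _ h => by
      simp only [decide_eq_true_eq] at h ⊢
      exact hI _ h _ d.adj.symm)
    (fun d _ h => by simp_all) (fun d _ h => by simp_all)
    (fun d h h' => by
      simp only [decide_eq_true_eq, Bool.and_eq_true] at h h'
      exact Finset.disjoint_left.1 hAI h'.2 h)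
    (fun d h h' => by simp_all) (fun d h h' => by simp_all)
  -- The dart leaving A ∪ I cannot start in I, so the third class is non-empty and |A| > |I| + k.
  obtain ⟨d, hd, hd1, hd2⟩ := (p.takeUntil b (hp.mem_support b)).exists_boundary_dart
    {y | y ∈ A ∨ y ∈ I} (Or.inr hx) (by simp [hbA, hbI])
  replace hd := p.darts_takeUntil_subset_darts _ hd
  simp only [Set.mem_ofPred_eq, not_or] at hd1 hd2
  rcases hd1 with hd1 | hd1
  · have : 0 < p.darts.countP
        (fun d => decide (d.fst ∈ A) && (decide (d.snd ∉ A) && decide (d.snd ∉ I))) :=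
      List.countP_pos_iff.2 ⟨d, hd, by simp [hd1, hd2]⟩
    omega
  · exact hd2.1 (hI _ hd1 _ d.adj)

/-- `G` is of the form `K_A + (I ∪ K_B)` up to the edges inside `B ≠ ∅`, with `I` independent. -/
structure IsBlockGraph (G : SimpleGraph V) (A I : Finset V) : Prop where
  disjoint : Disjoint A I
  adj_of_mem : ∀ x ∈ A, ∀ y, x ≠ y → G.Adj x y
  mem_of_adj : ∀ x ∈ I, ∀ y, G.Adj x y → y ∈ A
  exists_notMem : ∃ b, b ∉ A ∧ b ∉ I

lemma exists_isBlockGraph {n r m t : ℕ} {ℓ i : ℤ} (hn : Fintype.card V = n) (ht : 1 ≤ t)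
    (hℓ : ℓ + 1 = r) (hi : i = m + 1) (h : 2 * m + r + 2 ≤ n) :
    ∃ (G : SimpleGraph V) (A I : Finset V), IsBlockGraph G A I ∧ A.card = m + r ∧
      I.card = m + 1 ∧ starCount t (extremalGraph n ℓ i) = starCount t G := by
  rw [starCount_extremalGraph_eq hℓ hi h]
  have hc : 0 < n - 2 * m - r - 1 := by omega
  generalize hcc : n - 2 * m - r - 1 = c at hc
  have hcard : Fintype.card V = Fintype.card (Fin (m + r) ⊕ (Fin (m + 1) ⊕ Fin c)) := by
    simp only [Fintype.card_sum, Fintype.card_fin]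
    omega
  let e := Fintype.equivOfCardEq hcard
  refine ⟨(blockGraph (m + r) (m + 1) c).comap e,
    Finset.univ.map (Function.Embedding.inl.trans e.symm.toEmbedding),
    Finset.univ.map ((Function.Embedding.inl.trans Function.Embedding.inr).trans
      e.symm.toEmbedding), ⟨?_, ?_, ?_, ?_⟩, by simp, by simp, ?_⟩
  · rw [Finset.disjoint_left]
    simp
  · intro x hx y hxy
    obtain ⟨j, -, rfl⟩ := Finset.mem_map.1 hx
    rw [comap_adj]
    obtain ⟨y, rfl⟩ := e.symm.surjective y
    rcases y with y | y
    · simp at hxy ⊢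
      exact hxy
    · simp
  · intro x hx y hxy
    obtain ⟨j, -, rfl⟩ := Finset.mem_map.1 hx
    obtain ⟨y, rfl⟩ := e.symm.surjective y
    rw [comap_adj] at hxy
    rcases y with y | y
    · simp
    · simp at hxy
  · exact ⟨e.symm (.inr (.inr ⟨0, hc⟩)), by simp, by simp⟩
  · exact (starCount_congr (Iso.comap e _) ht).symm

namespace IsBlockGraph

variable {A I : Finset V} (h : IsBlockGraph G A I)

include h

lemma not_isHamiltonian (hI : I.Nonempty) (hcard : A.card = I.card) (hn : 3 ≤ Fintype.card V) :
    ¬ G.IsHamiltonian := by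
  intro hG
  -- `IsHamiltonian` holds by convention for one-vertex graphs, so a cycle is available only once
  -- that case is excluded.
  obtain ⟨a, p, hp⟩ := hG (by omega)
  exact not_hasHamiltonianCycleThrough (F := ⊥) (k := 0) h.disjoint h.mem_of_adj hI h.exists_notMem
    (by simp) (by simp) (by omega) ⟨a, p, hp, by simp⟩

/-- In the cone the apex joins A, which makes A and I equal in size. -/
lemma not_isTraceable (hcard : A.card + 1 = I.card) (hn : 2 ≤ Fintype.card V) :
    ¬ IsTraceable G := by
  intro hG
  refine not_hasHamiltonianCycleThrough (F := ⊥) (k := 0) (A := A.insertNone)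
    (I := I.map .some) ?_ ?_ ?_ ?_ (by simp) (by simp) (by simp; omega)
    (cone_hasHamiltonianCycleThrough hG hn)
  · rw [Finset.disjoint_left]
    rintro (_ | x) hx
    · simp
    · simpa using Finset.disjoint_left.1 h.disjoint (by simpa using hx)
  · rintro (_ | x) hx (_ | y) hxy
    · simp
    · simp at hx
    · simp
    · simpa using h.mem_of_adj x (by simpa using hx) y hxy
  · rw [Finset.map_nonempty, ← Finset.card_pos]; omega
  · obtain ⟨b, hbA, hbI⟩ := h.exists_notMem
    exact ⟨some b, by simpa using hbA, by simpa using hbI⟩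

lemma not_isHamiltonianConnected (hI : I.Nonempty) (hcard : A.card = I.card + 1)
    (hn : 3 ≤ Fintype.card V) : ¬ IsHamiltonianConnected G := by
  intro hG
  have := hI.card_pos
  -- A Hamilton path between two vertices of A would close up through their edge to a cycle
  -- containing a one-edge forest inside A.
  obtain ⟨a, ha, b, hb, hab⟩ := Finset.one_lt_card.1 (show 1 < A.card by omega)
  obtain ⟨p, hp⟩ := hG a b hab
  have hedge : (edge a b).edgeSet = {s(a, b)} := by
    ext e
    induction e with
    | h x y =>
      rw [mem_edgeSet, edge_adj, Set.mem_singleton_iff, Sym2.eq_iff]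
      grind
  refine not_hasHamiltonianCycleThrough (F := edge a b) (k := 1) h.disjoint h.mem_of_adj hI
    h.exists_notMem (fun x y hxy => ?_) (by rw [hedge]; simp) (by omega)
    ⟨_, _, isHamiltonianCycle_cons hp (h.adj_of_mem b hb a hab.symm) hn, ?_⟩
  · rw [edge_adj] at hxy
    rcases hxy.1 with ⟨rfl, -⟩ | ⟨rfl, -⟩ <;> assumption
  · rw [hedge]
    rintro e rfl
    rw [Walk.edges_cons, Sym2.eq_swap]
    exact List.mem_cons_self

lemma not_isEdgeHamiltonian {k : ℕ} (hI : I.Nonempty) (hcard : A.card = I.card + k) :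
    ¬ IsEdgeHamiltonian k G := by
  intro hG
  have := hI.card_pos
  -- A path on k + 1 vertices of the clique A is a forest with exactly k edges.
  obtain ⟨A', hA', hA'c⟩ := Finset.exists_subset_card_eq (show k + 1 ≤ A.card by omega)
  obtain ⟨F, -, -, hF, hFA, hFe, -⟩ :=
    exists_isLinearForest_of_nonempty (Finset.card_pos.1 (show 0 < A'.card by omega))
  have hFk : F.edgeSet.encard = k := by
    rw [hA'c, Nat.cast_add, Nat.cast_one] at hFe
    exact ENat.add_left_injective_of_ne_top ENat.one_ne_top hFe
  exact not_hasHamiltonianCycleThrough h.disjoint h.mem_of_adj hI h.exists_notMem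
    (fun x y hxy => hA' (hFA x y hxy)) hFk.ge hcard.le
    (hG F (fun x y hxy => h.adj_of_mem x (hA' (hFA x y hxy)) y hxy.ne) hF hFk.le)

lemma not_isVertexHamiltonian {k : ℕ} (hI : I.Nonempty) (hcard : A.card = I.card + k)
    (hn : k + 3 ≤ Fintype.card V) : ¬ IsVertexHamiltonian k G := by
  intro hG
  -- Deleting k vertices of A reduces it to the size of I.
  obtain ⟨S, hSA, hS⟩ := Finset.exists_subset_card_eq (show k ≤ A.card by omega)
  have hdis := Finset.disjoint_left.1 h.disjoint
  let p : V → Prop := fun v => v ∈ {v | v ∉ S}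
  have hb : IsBlockGraph (G.induce {v | v ∉ S}) (A.subtype p) (I.subtype p) := by
    refine ⟨?_, ?_, ?_, ?_⟩
    · rw [Finset.disjoint_left]
      intro x hx hx'
      rw [Finset.mem_subtype] at hx hx'
      exact hdis hx hx'
    · intro x hx y hxy
      rw [Finset.mem_subtype] at hx
      exact h.adj_of_mem x hx y fun h => hxy (Subtype.ext h)
    · intro x hx y hxy
      rw [Finset.mem_subtype] at hx ⊢
      exact h.mem_of_adj x hx y hxy
    · obtain ⟨b, hbA, hbI⟩ := h.exists_notMem
      exact ⟨⟨b, fun hbS => hbA (hSA hbS)⟩, by simpa using hbA, by simpa using hbI⟩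
  have hA' : (A.subtype p).card = I.card := by
    rw [Finset.card_subtype, show A.filter p = A \ S by ext; simp [p],
      Finset.card_sdiff_of_subset hSA]
    omega
  have hI' : (I.subtype p).card = I.card := by
    rw [Finset.card_subtype, Finset.filter_true_of_mem (p := p) fun x hx hxS => hdis (hSA hxS) hx]
  refine hb.not_isHamiltonian (Finset.card_pos.1 (by rw [hI']; exact hI.card_pos))
    (hA'.trans hI'.symm) ?_ (hG S hS.le)
  have h1 : Fintype.card {v | v ∉ S} = (Finset.univ \ S).card := by
    rw [Fintype.card_subtype]; congr 1; ext; simp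
  have h2 := Finset.card_sdiff_add_card_eq_card (Finset.subset_univ S)
  rw [Finset.card_univ] at h2
  omega

end IsBlockGraph

end Tightness

/-! ### Assembly of the bound and its attainment. -/

section Main

variable {V : Type*} [Fintype V]

/-- If failure of a property forces the degree condition and the property fails for the extremal
graphs, then the larger of the two extremal star counts is the maximum. -/
lemma isGreatest_starCount {n r t : ℕ} {ℓ : ℤ} (hn : Fintype.card V = n) (ht : 1 ≤ t)
    (hℓ : ℓ + 1 = r) (hr : r + 2 ≤ n) (P : SimpleGraph V → Prop)
    (hbound : ∀ G, ¬ P G → ∃ m, DegreeCondition G r m)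
    (htight : ∀ G A I, IsBlockGraph G A I → I.Nonempty → A.card + 1 = I.card + r → ¬ P G) :
    IsGreatest {s : ℕ | ∃ G : SimpleGraph V, ¬ P G ∧ s = starCount t G}
      (max (starCount t (extremalGraph n ℓ 1))
        (starCount t (extremalGraph n ℓ (topIndex n ℓ)))) := by
  classical
  constructor
  · have key : ∀ (m : ℕ) (i : ℤ), i = m + 1 → 2 * m + r + 2 ≤ n →
        ∃ G : SimpleGraph V, ¬ P G ∧ starCount t (extremalGraph n ℓ i) = starCount t G := by
      intro m i hi hm
      obtain ⟨G, A, I, hG, hA, hI, hs⟩ := exists_isBlockGraph hn ht hℓ hi hm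
      exact ⟨G, htight G A I hG (Finset.card_pos.1 (by omega)) (by omega), hs⟩
    rcases max_choice (starCount t (extremalGraph n ℓ 1))
      (starCount t (extremalGraph n ℓ (topIndex n ℓ))) with h | h <;> rw [h]
    · exact key 0 1 (by simp) (by omega)
    -- This is i₀ - 1; the subtraction is exact because n - r ≥ 2.
    · exact key ((n - r) / 2 - 1) _ (by unfold topIndex; omega) (by omega)
  · rintro s ⟨G, hG, rfl⟩
    obtain ⟨m, hm⟩ := hbound G hG
    exact hm.starCount_le hn ht hℓ

end Main
end StarCount

theorem corollary1p8 {V : Type*} [Fintype V] [DecidableEq V] (n t : ℕ)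
    (hn : Fintype.card V = n) (ht : 1 ≤ t) (htn : t ≤ n - 1) :
    -- (H1): not Hamiltonian, `ℓ = 0`
    (3 ≤ n → IsGreatest
      {s : ℕ | ∃ G : SimpleGraph V, ¬ G.IsHamiltonian ∧ s = StarCount.starCount t G}
      (max (StarCount.starCount t (StarCount.extremalGraph n 0 1))
        (StarCount.starCount t (StarCount.extremalGraph n 0 (StarCount.topIndex n 0))))) ∧
    -- (H2): not traceable, `ℓ = -1`
    (2 ≤ n → IsGreatest
      {s : ℕ | ∃ G : SimpleGraph V, ¬ StarCount.IsTraceable G ∧ s = StarCount.starCount t G}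
      (max (StarCount.starCount t (StarCount.extremalGraph n (-1) 1))
        (StarCount.starCount t (StarCount.extremalGraph n (-1) (StarCount.topIndex n (-1)))))) ∧
    -- (H3): not Hamiltonian-connected, `ℓ = 1`
    (4 ≤ n → IsGreatest
      {s : ℕ | ∃ G : SimpleGraph V,
        ¬ StarCount.IsHamiltonianConnected G ∧ s = StarCount.starCount t G}
      (max (StarCount.starCount t (StarCount.extremalGraph n 1 1))
        (StarCount.starCount t (StarCount.extremalGraph n 1 (StarCount.topIndex n 1))))) ∧
    -- (H4): not `k`-edge Hamiltonian for some `1 ≤ k ≤ n - 3`, `ℓ = k`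
    (∀ k : ℕ, 1 ≤ k → k + 3 ≤ n → IsGreatest
      {s : ℕ | ∃ G : SimpleGraph V,
        ¬ StarCount.IsEdgeHamiltonian k G ∧ s = StarCount.starCount t G}
      (max (StarCount.starCount t (StarCount.extremalGraph n k 1))
        (StarCount.starCount t (StarCount.extremalGraph n k (StarCount.topIndex n k))))) ∧
    -- (H5): not `k`-Hamiltonian for some `1 ≤ k ≤ n - 3`, `ℓ = k`
    (∀ k : ℕ, 1 ≤ k → k + 3 ≤ n → IsGreatest
      {s : ℕ | ∃ G : SimpleGraph V,
        ¬ StarCount.IsVertexHamiltonian k G ∧ s = StarCount.starCount t G}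
      (max (StarCount.starCount t (StarCount.extremalGraph n k 1))
        (StarCount.starCount t (StarCount.extremalGraph n k (StarCount.topIndex n k))))) := by
  open StarCount in
  refine ⟨fun h => ?_, fun h => ?_, fun h => ?_, fun k hk h => ?_, fun k hk h => ?_⟩
  · exact isGreatest_starCount (r := 1) hn ht (by norm_num) (by omega) (·.IsHamiltonian)
      (fun G hG => exists_degreeCondition_of_not_isHamiltonian (by omega) hG)
      (fun G A I hb hI hc => hb.not_isHamiltonian hI (by omega) (by omega))
  · exact isGreatest_starCount (r := 0) hn ht (by norm_num) (by omega) (IsTraceable ·)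
      (fun G hG => exists_degreeCondition_of_not_isTraceable (by omega) hG)
      (fun G A I hb hI hc => hb.not_isTraceable (by omega) (by omega))
  · exact isGreatest_starCount (r := 2) hn ht (by norm_num) (by omega) (IsHamiltonianConnected ·)
      (fun G hG => exists_degreeCondition_of_not_isHamiltonianConnected (by omega) hG)
      (fun G A I hb hI hc => hb.not_isHamiltonianConnected hI (by omega) (by omega))
  · exact isGreatest_starCount (r := k + 1) hn ht (by norm_num) (by omega) (IsEdgeHamiltonian k ·)
      (fun G hG => exists_degreeCondition_of_not_isEdgeHamiltonian (by omega) hG)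
      (fun G A I hb hI hc => hb.not_isEdgeHamiltonian hI (by omega))
  · exact isGreatest_starCount (r := k + 1) hn ht (by norm_num) (by omega)
      (IsVertexHamiltonian k ·)
      (fun G hG => exists_degreeCondition_of_not_isVertexHamiltonian (by omega) hG)
      (fun G A I hb hI hc => hb.not_isVertexHamiltonian hI (by omega) (by omega))
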